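/- **Setting.** Let $d\in\{2,3\}$, let $\Omega\subset\mathbb{R}^d$ be open with Lipschitz boundary, let $\Gamma_D\subseteq\partial\Omega$ be closed with positive surface measure, and put $\Gamma_N:=\partial\Omega\setminus\Gamma_D$. Let $V:=\{v\in H^1(\Omega;\mathbb{R}^d)\mid v=0\text{ on }\Gamma_D\}$, $\varepsilon(v):=\frac12(\nabla v+(\nabla v)^T)$, and let $\mathbb{S}_d$ and $\mathbb{S}_{d,0}$ be the symmetric, respectively the symmetric trace-free, real $d\times d$ matrices. An elasticity tensor $\mathbb{C}$ is a constant linear map on $\mathbb{S}_d$ that is symmetric and elliptic with respect to $\sigma:\tau=\sum_{i,j}\sigma_{ij}\tau_{ij}$, i.e. $\kappa_{\mathbb{C}}|\tau|^2\le\mathbb{C}\tau:\tau$ for all $\tau\in\mathbb{S}_d$, with some $\kappa_{\mathbb{C}}>0$. For $z=(v,q,\beta)$ with $v\in V$, $q\in L^2(\Omega;\mathbb{S}_{d,0})$, $\beta\in L^2(\Omega)$ let $\sigma(z):=\mathbb{C}(\varepsilon(v)-q)$ and $$\mathrm{d}[\hat z,z]:=\|\sigma(\hat z)-\sigma(z)\|_{L^2(\Omega;\mathbb{R}^{d\times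 d})}.$$ A mesh is a finite conforming decomposition of $\overline\Omega$ into closed nondegenerate triangles ($d=2$) or tetrahedra ($d=3$); each of its boundary edges (faces, if $d=3$) lies, up to surface measure zero, either on $\Gamma_D$ or on $\Gamma_N$. For a mesh $\mathcal{T}$ let $X(\mathcal{T})$ be the set of all $z=(v,q,\beta)$ as above with $v$ affine and $q,\beta$ constant on each element of $\mathcal{T}$. For $f\in L^2(\Omega;\mathbb{R}^d)$, $g\in L^2(\Gamma_N;\mathbb{R}^d)$, $T\in\mathcal{T}$ and $z\in X(\mathcal{T})$ let $\eta_T(\mathcal{T};z)\ge 0$ be given by $$\eta_T(\mathcal{T};z)^2:=|T|\,\|f\|_{L^2(T)}^2+|T|^{1/2}\sum_{E\in\mathcal{E}(T)}R_E(z)^2,$$ where $\mathcal{E}(T)$ is the set of edges (faces) of $T$, and $R_E(z)$ is $\|[\sigma(z)]\nu_E\|_{L^2(E)}$ for interior $E$, $\|g-\sigma(z)\nu_E\|_{L^2(E)}$ for $E$ on $\Gamma_N$, and $0$ for $E$ on $\Gamma_D$; here $[\cdot]$ is the jump across $E$ and $\nu_E$ is a unit normal of $E$ (the outer one if $E$ lies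 on $\partial\Omega$). Elements are tagged, $T=(z_0,\dots,z_d)_\gamma$, with ordered vertices $z_0,\dots,z_d$, reference edge $z_0z_d$ and type $\gamma\in\{0,\dots,d-1\}$. With $m:=\frac12(z_0+z_d)$, the bisection of $T$ yields the two children $(z_0,m,z_1,\dots,z_{d-1})_{\gamma'}$ and $(z_d,m,z_1,\dots,z_\gamma,z_{d-1},\dots,z_{\gamma+1})_{\gamma'}$, $\gamma':=(\gamma+1)\bmod d$. The newest vertex bisection of a mesh with a set of marked elements bisects the marked elements, and then repeatedly all elements that have a hanging node (a vertex of the current mesh in the interior of one of their edges), until no hanging node is left; the result is required to be conforming. Let $\mathbb{T}(\mathcal{T})$ be the set of all meshes created from $\mathcal{T}$ by finitely many successive newest vertex bisections, with arbitrary marked sets. **Lemma (A1, stability on non-refined elements).** Let $\mathcal{T}_0$ be a (tagged) mesh of $\Omega$. There exists a constant $C_1>0$, which depends only on $d$, $\Omega$, $\Gamma_D$ and $\mathcal{T}_0$, such that for all $\mathbb{C}$, $f$ and $g$ as above $$\bigg|\bigg(\sum_{T\in\mathcal{S}}\eta_T(\hat{\mathcal{T}};\hat z)^2\bigg)^{1/2}-\bigg(\sum_{T\in\mathcal{S}}\eta_T(\mathcal{T};z)^2\bigg)^{1/2}\bigg|\le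 C_1\,\mathrm{d}[\hat z,z]$$ for all $\mathcal{T}\in\mathbb{T}(\mathcal{T}_0)$, $\hat{\mathcal{T}}\in\mathbb{T}(\mathcal{T})$, $\mathcal{S}\subseteq\mathcal{T}\cap\hat{\mathcal{T}}$, $z\in X(\mathcal{T})$ and $\hat z\in X(\hat{\mathcal{T}})$. -/

import Mathlib

open MeasureTheory Filter Topology

noncomputable section

namespace Elastoplasticity

open scoped ENNReal ContDiff RealInnerProductSpace

/-- Points and vectors of `ℝ^d`. -/
abbrev Pt (d : ℕ) := EuclideanSpace ℝ (Fin d)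

/-- Tensors, i.e. real `d × d` matrices. -/
abbrev Mat (d : ℕ) := Matrix (Fin d) (Fin d) ℝ

/-- A matrix as the vector of its entries, with the Euclidean (i.e. Frobenius) norm. It is used to
speak of the `L²`-norm of tensor fields. -/
def flat {d : ℕ} (τ : Mat d) : EuclideanSpace ℝ (Fin d × Fin d) :=
  WithLp.toLp 2 fun p => τ p.1 p.2

/-- The surface measure: `(d-1)`-dimensional Hausdorff measure in `ℝ^d`, normalised so that it is
the usual length for `d = 2` and the usual area for `d = 3`. -/
def surf (d : ℕ) : Measure (Pt d) := μHE[d - 1]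

/-- The norm of `L²(μ)`. -/
def l2norm {d : ℕ} {F : Type*} [NormedAddCommGroup F] (h : Pt d → F) (μ : Measure (Pt d)) : ℝ :=
  (eLpNorm h 2 μ).toReal

/-! ### The reference domain -/

/-- `Ω` has a Lipschitz boundary: near each boundary point it is, in suitable Cartesian
coordinates, the region strictly above the graph of a Lipschitz function. Here `e` is the vertical
direction and `y - ⟪e, y⟫ • e` the horizontal part of `y`. -/
def HasLipschitzBoundary {d : ℕ} (Ω : Set (Pt d)) : Prop :=
  ∀ x ∈ frontier Ω, ∃ U : Set (Pt d), IsOpen U ∧ x ∈ U ∧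
    ∃ e : Pt d, ‖e‖ = 1 ∧ ∃ (K : NNReal) (φ : Pt d → ℝ), LipschitzWith K φ ∧
      ∀ y ∈ U, (y ∈ Ω ↔ φ (y - ⟪e, y⟫ • e) < ⟪e, y⟫)

/-- A reference domain `Ω` with Dirichlet boundary part `ΓD`. -/
structure IsReferenceDomain {d : ℕ} (Ω ΓD : Set (Pt d)) : Prop where
  isOpen : IsOpen Ω
  lipschitz : HasLipschitzBoundary Ω
  isClosed_dirichlet : IsClosed ΓD
  dirichlet_subset : ΓD ⊆ frontier Ω
  dirichlet_pos : 0 < surf d ΓD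

/-- The Neumann part of the boundary. -/
def neumann {d : ℕ} (Ω ΓD : Set (Pt d)) : Set (Pt d) := frontier Ω \ ΓD

/-! ### Tagged simplices, meshes, newest vertex bisection -/

/-- A tagged simplex `(z₀, …, z_d)_γ`: an ordered list of vertices and a type `γ`. Its reference
edge is the segment from `z₀` to `z_d`. -/
@[ext] structure TSimplex (d : ℕ) where
  vert : Fin (d + 1) → Pt d
  typ : ℕ

namespace TSimplex

variable {d : ℕ}

/-- The closed simplex as a subset of `ℝ^d`. -/
def toSet (T : TSimplex d) : Set (Pt d) := convexHull ℝ (Set.range T.vert)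

/-- The measure `|T|`. -/
def vol (T : TSimplex d) : ℝ := (volume T.toSet).toReal

/-- The vertices of the edge (`d = 2`) or face (`d = 3`) opposite to the vertex `i`. -/
def faceVert (T : TSimplex d) (i : Fin (d + 1)) : Set (Pt d) := T.vert '' {i}ᶜ

/-- The closed edge (`d = 2`) or face (`d = 3`) opposite to the vertex `i`. -/
def face (T : TSimplex d) (i : Fin (d + 1)) : Set (Pt d) := convexHull ℝ (T.faceVert i)

/-- The outer unit normal of `T` on its face opposite to the vertex `i`: the normalised negative of
the component, orthogonal to the face, of an edge running from the face to the vertex `i`. -/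
def normal (T : TSimplex d) (i : Fin (d + 1)) : Pt d :=
  let w : Pt d := (vectorSpan ℝ (T.faceVert i))ᗮ.starProjection (T.vert i - T.vert (i + 1));
  -(‖w‖⁻¹ • w)

/-- The midpoint of the reference edge (the newest vertex). -/
def newVertex (T : TSimplex d) : Pt d := midpoint ℝ (T.vert 0) (T.vert (Fin.last d))

/-- The child `(z₀, m, z₁, …, z_{d-1})` of type `γ + 1 mod d`, with `m` the newest vertex. -/
def child₁ (T : TSimplex d) : TSimplex d where
  vert k := if k = 0 then T.vert 0 else if k = 1 then T.newVertex
    else T.vert (Fin.ofNat (d + 1) (k.val - 1))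
  typ := (T.typ + 1) % d

/-- The child `(z_d, m, z₁, …, z_γ, z_{d-1}, …, z_{γ+1})` of type `γ + 1 mod d`, with `m` the newest
vertex. -/
def child₂ (T : TSimplex d) : TSimplex d where
  vert k := if k = 0 then T.vert (Fin.last d) else if k = 1 then T.newVertex
    else if k.val - 1 ≤ T.typ then T.vert (Fin.ofNat (d + 1) (k.val - 1))
    else T.vert (Fin.ofNat (d + 1) (d + T.typ - (k.val - 1)))
  typ := (T.typ + 1) % d

end TSimplex

/-- A finite family of simplices. -/
abbrev Mesh (d : ℕ) := Finset (TSimplex d)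

/-- Conformity: two distinct elements meet exactly in the common subsimplex (face, edge, vertex, or
the empty set) that is spanned by their common vertices. -/
def IsConforming {d : ℕ} (𝒯 : Mesh d) : Prop :=
  ∀ T ∈ 𝒯, ∀ T' ∈ 𝒯, T ≠ T' → Set.range T.vert ≠ Set.range T'.vert ∧
    T.toSet ∩ T'.toSet = convexHull ℝ (Set.range T.vert ∩ Set.range T'.vert)

/-- The face `i` of the element `T` is also a face of the different element `T'`. -/
def SharesFace {d : ℕ} (T : TSimplex d) (i : Fin (d + 1)) (T' : TSimplex d) : Prop :=
  T' ≠ T ∧ ∃ j, T'.faceVert j = T.faceVert i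

/-- The face `i` of `T` is an interior face of the mesh. -/
def IsInteriorFace {d : ℕ} (𝒯 : Mesh d) (T : TSimplex d) (i : Fin (d + 1)) : Prop :=
  ∃ T' ∈ 𝒯, SharesFace T i T'

/-- The face `i` of `T` lies on the Neumann boundary, up to a set of surface measure zero (such as
end points that belong to the closed Dirichlet part). -/
def IsNeumannFace {d : ℕ} (Ω ΓD : Set (Pt d)) (T : TSimplex d) (i : Fin (d + 1)) : Prop :=
  surf d (T.face i \ neumann Ω ΓD) = 0

/-- A (tagged) conforming mesh of `Ω` whose boundary faces each lie on one of the two parts of the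
boundary. -/
structure IsMesh {d : ℕ} (Ω ΓD : Set (Pt d)) (𝒯 : Mesh d) : Prop where
  nondegenerate : ∀ T ∈ 𝒯, AffineIndependent ℝ T.vert
  typ_lt : ∀ T ∈ 𝒯, T.typ < d
  cover : closure Ω = ⋃ T ∈ 𝒯, T.toSet
  conforming : IsConforming 𝒯
  resolves : ∀ T ∈ 𝒯, ∀ i, ¬ IsInteriorFace 𝒯 T i →
    T.face i ⊆ ΓD ∨ IsNeumannFace Ω ΓD T i

open scoped Classical in
/-- Replace each marked element by its two children. -/
def bisect {d : ℕ} (𝒯 M : Mesh d) : Mesh d :=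
  (𝒯 \ M) ∪ M.biUnion fun T => {T.child₁, T.child₂}

/-- `T` has a hanging node: some vertex of the mesh lies in the interior of an edge of `T`. -/
def HasHangingNode {d : ℕ} (𝒯 : Mesh d) (T : TSimplex d) : Prop :=
  ∃ T' ∈ 𝒯, ∃ k i j, i ≠ j ∧ T'.vert k ∈ openSegment ℝ (T.vert i) (T.vert j)

open scoped Classical in
/-- One pass of the mesh closure: bisect all elements that have a hanging node. -/
def closurePass {d : ℕ} (𝒯 : Mesh d) : Mesh d :=
  bisect 𝒯 (𝒯.filter (HasHangingNode 𝒯))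

/-- `𝒯'` is the mesh `NVB(𝒯, M)`: it arises from bisecting the elements of `M`, followed by
passes of the mesh closure until no hanging nodes are left. As always for meshes, the result is a
conforming one. -/
def IsNVB {d : ℕ} (𝒯 M 𝒯' : Mesh d) : Prop :=
  (∃ n : ℕ, 𝒯' = closurePass^[n] (bisect 𝒯 M)) ∧
    (∀ T ∈ 𝒯', ¬ HasHangingNode 𝒯' T) ∧ IsConforming 𝒯'

/-- `𝕋(𝒯)`: the meshes created from `𝒯` by finitely many newest vertex bisections. -/
def refinements {d : ℕ} (𝒯 : Mesh d) : Set (Mesh d) :=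
  {𝒯' | Relation.ReflTransGen (fun A B => ∃ M ⊆ A, IsNVB A M B) 𝒯 𝒯'}

/-! ### Function spaces

Elements of Lebesgue and Sobolev spaces are represented by functions on `ℝ^d` of which only the
values almost everywhere in `Ω` matter. -/

/-- `G` is the weak gradient of `v` in `Ω`, with `G i j = ∂_j v_i`. -/
def IsWeakGradient {d : ℕ} (Ω : Set (Pt d)) (v : Pt d → Pt d) (G : Pt d → Mat d) : Prop :=
  ∀ φ : Pt d → ℝ, ContDiff ℝ ∞ φ → HasCompactSupport φ → tsupport φ ⊆ Ω →
    ∀ i j, ∫ x in Ω, v x i * fderiv ℝ φ x (EuclideanSpace.single j 1) =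
      - ∫ x in Ω, G x i j * φ x

/-- `v ∈ H¹(Ω; ℝ^d)`. -/
def MemH1 {d : ℕ} (Ω : Set (Pt d)) (v : Pt d → Pt d) : Prop :=
  MemLp v 2 (volume.restrict Ω) ∧
    ∃ G : Pt d → Mat d, MemLp (fun x => flat (G x)) 2 (volume.restrict Ω) ∧ IsWeakGradient Ω v G

open scoped Classical in
/-- The weak gradient `∇v ∈ L²(Ω; ℝ^{d×d})` of `v ∈ H¹(Ω; ℝ^d)` (unique almost everywhere). -/
def weakGrad {d : ℕ} (Ω : Set (Pt d)) (v : Pt d → Pt d) : Pt d → Mat d :=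
  if h : ∃ G : Pt d → Mat d,
      MemLp (fun x => flat (G x)) 2 (volume.restrict Ω) ∧ IsWeakGradient Ω v G
  then h.choose else 0

/-- The classical gradient of a differentiable vector field. -/
def jacobian {d : ℕ} (φ : Pt d → Pt d) (x : Pt d) : Mat d :=
  Matrix.of fun i j => fderiv ℝ φ x (EuclideanSpace.single j 1) i

/-- `t ∈ L²(∂Ω; ℝ^d)` is the boundary trace of `v ∈ H¹(Ω; ℝ^d)`: it is the `L²(∂Ω)`-limit of the
boundary values of some smooth fields that converge to `v` in `H¹(Ω)`. -/
def IsTrace {d : ℕ} (Ω : Set (Pt d)) (v t : Pt d → Pt d) : Prop :=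
  MemLp t 2 ((surf d).restrict (frontier Ω)) ∧
  ∃ φ : ℕ → Pt d → Pt d, (∀ n, ContDiff ℝ ∞ (φ n)) ∧
    Tendsto (fun n => eLpNorm (φ n - v) 2 (volume.restrict Ω)) atTop (𝓝 0) ∧
    Tendsto (fun n => eLpNorm (fun x => flat (jacobian (φ n) x - weakGrad Ω v x)) 2
      (volume.restrict Ω)) atTop (𝓝 0) ∧
    Tendsto (fun n => eLpNorm (φ n - t) 2 ((surf d).restrict (frontier Ω))) atTop (𝓝 0)

/-- `V = {v ∈ H¹(Ω; ℝ^d) | v = 0 on ΓD}`. -/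
def spaceV {d : ℕ} (Ω ΓD : Set (Pt d)) : Set (Pt d → Pt d) :=
  {v | MemH1 Ω v ∧ ∃ t, IsTrace Ω v t ∧ ∀ᵐ x ∂((surf d).restrict ΓD), t x = 0}

/-- The symmetric trace-free matrices. -/
def devSym (d : ℕ) : Set (Mat d) := {q | q.IsSymm ∧ q.trace = 0}

/-- `Q = L²(Ω; 𝕊_{d,0})`. -/
def spaceQ {d : ℕ} (Ω : Set (Pt d)) : Set (Pt d → Mat d) :=
  {q | MemLp (fun x => flat (q x)) 2 (volume.restrict Ω) ∧
    ∀ᵐ x ∂(volume.restrict Ω), q x ∈ devSym d}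

/-- `M = L²(Ω)`. -/
def spaceM {d : ℕ} (Ω : Set (Pt d)) : Set (Pt d → ℝ) := {β | MemLp β 2 (volume.restrict Ω)}

/-- Piecewise affine vector fields with respect to a mesh. -/
def piecewiseAffine {d : ℕ} (𝒯 : Mesh d) : Set (Pt d → Pt d) :=
  {v | ∀ T ∈ 𝒯, ∃ A : Pt d →ᵃ[ℝ] Pt d, v =ᵐ[volume.restrict T.toSet] A}

/-- Piecewise constant functions with respect to a mesh. -/
def piecewiseConst {d : ℕ} {F : Type*} (𝒯 : Mesh d) : Set (Pt d → F) :=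
  {q | ∀ T ∈ 𝒯, ∃ c : F, q =ᵐ[volume.restrict T.toSet] fun _ => c}

/-- A triple of a displacement, a plastic strain and an accumulated plastic strain. -/
structure State (d : ℕ) where
  v : Pt d → Pt d
  q : Pt d → Mat d
  β : Pt d → ℝ

/-- `X(𝒯) = V(𝒯) × Q(𝒯) × M(𝒯)`. -/
def discreteSpace {d : ℕ} (Ω ΓD : Set (Pt d)) (𝒯 : Mesh d) : Set (State d) :=
  {z | z.v ∈ piecewiseAffine 𝒯 ∩ spaceV Ω ΓD ∧ z.q ∈ piecewiseConst 𝒯 ∩ spaceQ Ω ∧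
    z.β ∈ piecewiseConst 𝒯 ∩ spaceM Ω}

/-! ### Stresses, error measure, error estimator -/

/-- The scalar product `σ : τ` of matrices. -/
def ddot {d : ℕ} (σ τ : Mat d) : ℝ := ∑ i, ∑ j, σ i j * τ i j

/-- A constant elasticity tensor: a symmetric and elliptic linear map on the symmetric matrices. -/
structure IsElasticityTensor {d : ℕ} (C : Mat d →ₗ[ℝ] Mat d) : Prop where
  mapsTo : ∀ τ : Mat d, τ.IsSymm → (C τ).IsSymm
  symm : ∀ σ τ : Mat d, σ.IsSymm → τ.IsSymm → ddot (C σ) τ = ddot σ (C τ)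
  elliptic : ∃ κ > 0, ∀ τ : Mat d, τ.IsSymm → κ * ddot τ τ ≤ ddot (C τ) τ

/-- The linearised strain `ε(v)`. -/
def strain {d : ℕ} (Ω : Set (Pt d)) (v : Pt d → Pt d) (x : Pt d) : Mat d :=
  (1 / 2 : ℝ) • (weakGrad Ω v x + (weakGrad Ω v x).transpose)

/-- The stress `σ(v, q) = C (ε(v) - q)` of a state. -/
def stress {d : ℕ} (Ω : Set (Pt d)) (C : Mat d →ₗ[ℝ] Mat d) (z : State d) (x : Pt d) : Mat d :=
  C (strain Ω z.v x - z.q x)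

/-- The error measure: the `L²(Ω)`-distance of the stresses. -/
def errorMeasure {d : ℕ} (Ω : Set (Pt d)) (C : Mat d →ₗ[ℝ] Mat d) (z z' : State d) : ℝ :=
  l2norm (fun x => flat (stress Ω C z x - stress Ω C z' x)) (volume.restrict Ω)

/-- The trace, taken from inside `T`, of the stress of a discrete state on the faces of `T`. This
stress is constant almost everywhere on `T`; the constant is recovered as the mean value. -/
def elementStress {d : ℕ} (Ω : Set (Pt d)) (C : Mat d →ₗ[ℝ] Mat d) (z : State d)
    (T : TSimplex d) : Mat d :=
  Matrix.of fun i j => ⨍ x in T.toSet, stress Ω C z x i j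

/-- The product `σ ν` of a matrix and a vector. -/
def matVec {d : ℕ} (σ : Mat d) (ν : Pt d) : Pt d := WithLp.toLp 2 (σ.mulVec ν.ofLp)

open scoped Classical in
/-- The jump of the stress across the face `i` of `T`: the value on `T` minus the value on the
neighbour (the only element that shares this face with `T`). -/
def stressJump {d : ℕ} (Ω : Set (Pt d)) (C : Mat d →ₗ[ℝ] Mat d) (𝒯 : Mesh d) (z : State d)
    (T : TSimplex d) (i : Fin (d + 1)) : Mat d :=
  ∑ T' ∈ 𝒯.filter (SharesFace T i), (elementStress Ω C z T - elementStress Ω C z T')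

open scoped Classical in
/-- The face residual `R_E(z)` for the face `E` of `T` opposite to the vertex `i`: interior faces,
Neumann faces, Dirichlet faces. -/
def faceResidual {d : ℕ} (Ω ΓD : Set (Pt d)) (C : Mat d →ₗ[ℝ] Mat d) (g : Pt d → Pt d)
    (𝒯 : Mesh d) (z : State d) (T : TSimplex d) (i : Fin (d + 1)) : ℝ :=
  if IsInteriorFace 𝒯 T i then
    l2norm (fun _ => matVec (stressJump Ω C 𝒯 z T i) (T.normal i)) ((surf d).restrict (T.face i))
  else if IsNeumannFace Ω ΓD T i then
    l2norm (fun x => g x - matVec (elementStress Ω C z T) (T.normal i))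
      ((surf d).restrict (T.face i))
  else 0

/-- The refinement indicator `η_T(𝒯; z)`, whose square is
`|T| ‖f‖²_{L²(T)} + |T|^{1/2} ∑_{E ∈ ℰ(T)} R_E(z)²`. -/
def refinementIndicator {d : ℕ} (Ω ΓD : Set (Pt d)) (C : Mat d →ₗ[ℝ] Mat d) (f g : Pt d → Pt d)
    (𝒯 : Mesh d) (z : State d) (T : TSimplex d) : ℝ :=
  Real.sqrt (T.vol * l2norm f (volume.restrict T.toSet) ^ 2 +
    Real.sqrt T.vol * ∑ i, faceResidual Ω ΓD C g 𝒯 z T i ^ 2)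

end Elastoplasticity

end

open Elastoplasticity

/-!
The indicators of a non-refined element `T` differ only in the face residuals, since the volume term
`|T| ‖f‖²` does not depend on the mesh or the state. By the reverse triangle inequality, everything
reduces to bounding `|T|^{1/2} |R_E(ẑ) - R_E(z)|²` for the faces `E` of `T`.

The stress of a discrete state is constant on each element: a weak gradient that comes from an affine
map is constant by the fundamental lemma of the calculus of variations, applied in the part of
the element inside `Ω`, and `∂Ω` is a null set because it is locally a graph
(`stress_ae_eq_elementStress`). Let `δ_T` be the difference of the two stresses on an element `T` of
the finer mesh. Then `d[ẑ, z]² = ∑ |T| ‖δ_T‖²` over this mesh (`l2norm_sq_eq_sum`).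

A face of `T` is interior in both meshes or in none, and the neighbour of `T` in the finer mesh is a
part of its neighbour in the coarser one (`Refines.exists_neighbour`). Hence the residual on a face
with neighbour `P` in the finer mesh changes by at most `(‖δ_T‖ + ‖δ_P‖) |E|^{1/2}`; on a boundary
face the term with `P` is absent (`abs_faceResidual_sub_le`). The neighbour is unique, as two of three
elements with a common face would lie on the same side of it and overlap
(`IsConforming.sharesFace_unique`); this is also why each element is a neighbour at most
`d + 1` times (`IsConforming.sum_neighbours_le`).

It remains to see that `|T|^{1/2} |E| ≲ |T|` and `|T|^{1/2} |E| ≲ |P|`. Up to translation and scaling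
with a power of `2`, bisection creates only finitely many simplices from the initial mesh:
a tagged simplex is given by its type and a frame of `d` vectors, and the frames of its children
consist of the same vectors up to order and sign, halved when the type returns to `0`
(`hereditary_hasFrameIn`). So `|T| ~ h^d`, `|E| ~ h^{d-1}` and all edges have length `~ h` for some
`h ≤ 1` (`exists_isShapeRegular`). Elements with a common face have a common edge, hence comparable
sizes, and `h^{d/2} ≤ h` because `d ≥ 2` (`IsShapeRegular.sqrt_vol_mul_surf_le`).
-/

noncomputable section

namespace Elastoplasticity

open scoped ENNReal ContDiff RealInnerProductSpace

/-! ### Geometry of nondegenerate simplices -/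

namespace TSimplex

variable {d : ℕ} {T T' T'' : TSimplex d}

/-- The vertices of a nondegenerate simplex as an affine basis; its coordinates are the barycentric
coordinates with respect to the simplex. -/
def basis (hT : AffineIndependent ℝ T.vert) : AffineBasis (Fin (d + 1)) ℝ (Pt d) where
  toFun := T.vert
  ind' := hT
  tot' := by
    rw [hT.affineSpan_eq_top_iff_card_eq_finrank_add_one]
    simp

@[simp] lemma basis_apply (hT : AffineIndependent ℝ T.vert) (k : Fin (d + 1)) :
    basis hT k = T.vert k := rfl

lemma coe_basis (hT : AffineIndependent ℝ T.vert) : ⇑(basis hT) = T.vert := rfl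

lemma mem_toSet_iff (hT : AffineIndependent ℝ T.vert) {x : Pt d} :
    x ∈ T.toSet ↔ ∀ k, 0 ≤ (basis hT).coord k x := by
  have := (basis hT).convexHull_eq_nonneg_coord
  rw [coe_basis] at this
  rw [toSet, this]
  rfl

lemma isCompact_toSet (T : TSimplex d) : IsCompact T.toSet :=
  (Set.finite_range _).isCompact_convexHull (𝕜 := ℝ)

lemma measurableSet_toSet (T : TSimplex d) : MeasurableSet T.toSet :=
  T.isCompact_toSet.isClosed.measurableSet

lemma convex_toSet (T : TSimplex d) : Convex ℝ T.toSet := convex_convexHull _ _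

lemma vert_mem_toSet (T : TSimplex d) (k : Fin (d + 1)) : T.vert k ∈ T.toSet :=
  subset_convexHull _ _ ⟨k, rfl⟩

lemma volume_toSet_lt_top (T : TSimplex d) : volume T.toSet < ⊤ :=
  T.isCompact_toSet.measure_lt_top

lemma interior_toSet_nonempty (hT : AffineIndependent ℝ T.vert) : (interior T.toSet).Nonempty := by
  rw [toSet, interior_convexHull_nonempty_iff_affineSpan_eq_top]
  exact (basis hT).tot

lemma volume_toSet_pos (hT : AffineIndependent ℝ T.vert) : 0 < volume T.toSet :=
  Measure.measure_pos_of_nonempty_interior _ (interior_toSet_nonempty hT)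

lemma vol_pos (hT : AffineIndependent ℝ T.vert) : 0 < T.vol :=
  ENNReal.toReal_pos (volume_toSet_pos hT).ne' T.volume_toSet_lt_top.ne

lemma vol_nonneg (T : TSimplex d) : 0 ≤ T.vol := ENNReal.toReal_nonneg

lemma ofReal_vol (T : TSimplex d) : ENNReal.ofReal T.vol = volume T.toSet :=
  ENNReal.ofReal_toReal T.volume_toSet_lt_top.ne

lemma volume_frontier_toSet (T : TSimplex d) : volume (frontier T.toSet) = 0 :=
  T.convex_toSet.addHaar_frontier volume

lemma face_subset_toSet (T : TSimplex d) (i : Fin (d + 1)) : T.face i ⊆ T.toSet :=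
  convexHull_mono (Set.image_subset_range _ _)

lemma vert_mem_faceVert_iff (hT : AffineIndependent ℝ T.vert) {i k : Fin (d + 1)} :
    T.vert k ∈ T.faceVert i ↔ k ≠ i := by
  simp [faceVert, hT.injective.eq_iff]

lemma faceVert_injective (hT : AffineIndependent ℝ T.vert) : Function.Injective T.faceVert := by
  intro i j h
  by_contra hij
  have : T.vert i ∈ T.faceVert j := (vert_mem_faceVert_iff hT).2 hij
  rw [← h, vert_mem_faceVert_iff hT] at this
  exact this rfl

/-- A barycentric coordinate vanishes on every subsimplex that misses the corresponding vertex. -/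
lemma coord_eq_zero_of_mem_convexHull (hT : AffineIndependent ℝ T.vert) {A : Set (Pt d)}
    (hA : A ⊆ Set.range T.vert) {k : Fin (d + 1)} (hk : T.vert k ∉ A) {x : Pt d}
    (hx : x ∈ convexHull ℝ A) : (basis hT).coord k x = 0 := by
  have hsub : A ⊆ (basis hT).coord k ⁻¹' {0} := by
    intro y hy
    obtain ⟨l, rfl⟩ := hA hy
    have hlk : k ≠ l := by rintro rfl; exact hk hy
    simpa using (basis hT).coord_apply_ne hlk
  have hconv : Convex ℝ ((basis hT).coord k ⁻¹' {0}) :=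
    (convex_singleton (0 : ℝ)).affine_preimage _
  exact convexHull_min hsub hconv hx

/-- The barycentre of the face opposite to the vertex `i`. -/
def faceCenter (T : TSimplex d) (i : Fin (d + 1)) : Pt d :=
  (Finset.univ.erase i).centroid ℝ T.vert

lemma faceCenter_mem_face (hd : d ≠ 0) (T : TSimplex d) (i : Fin (d + 1)) :
    T.faceCenter i ∈ T.face i := by
  have hcard : (Finset.univ.erase i).card = d := by simp
  have h : ∑ k ∈ Finset.univ.erase i, (Finset.univ.erase i).centroidWeights ℝ k = 1 :=
    Finset.sum_centroidWeights_eq_one_of_card_ne_zero _ _ (hcard.symm ▸ hd)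
  have := affineCombination_mem_convexHull (R := ℝ) (s := Finset.univ.erase i) (v := T.vert)
    (w := (Finset.univ.erase i).centroidWeights ℝ) (by intro k _; simp) h
  rw [faceCenter, face, faceVert, Finset.centroid_def]
  rw [Finset.affineCombination_eq_linear_combination _ _ _ h]
  rw [← Finset.centerMass_eq_of_sum_1 _ _ h]
  refine Finset.centerMass_mem_convexHull _ (by intro k _; simp) (by rw [h]; norm_num) ?_
  intro k hk
  exact ⟨k, by simpa using hk, rfl⟩

lemma coord_faceCenter_pos (hT : AffineIndependent ℝ T.vert) {i k : Fin (d + 1)}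
    (hk : k ≠ i) : 0 < (basis hT).coord k (T.faceCenter i) := by
  have := (basis hT).coord_apply_centroid (s := Finset.univ.erase i) (i := k) (by simp [hk])
  rw [coe_basis] at this
  rw [faceCenter, this]
  simp
  omega

lemma coord_opposite_eq_zero (hT : AffineIndependent ℝ T.vert) {i : Fin (d + 1)} {x : Pt d}
    (hx : x ∈ T.face i) : (basis hT).coord i x = 0 :=
  coord_eq_zero_of_mem_convexHull hT (Set.image_subset_range _ _)
    (fun h => (vert_mem_faceVert_iff hT).1 h rfl) hx

/-- A subsimplex that contains the barycentre of a face contains all vertices of this face. -/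
lemma faceVert_subset_of_faceCenter_mem (hT : AffineIndependent ℝ T.vert)
    {A : Set (Pt d)} (hA : A ⊆ Set.range T.vert) {i : Fin (d + 1)}
    (hx : T.faceCenter i ∈ convexHull ℝ A) : T.faceVert i ⊆ A := by
  rintro _ ⟨k, hk, rfl⟩
  by_contra hkA
  exact (coord_faceCenter_pos hT hk).ne'
    (coord_eq_zero_of_mem_convexHull hT hA hkA hx)

/-- A nondegenerate simplex which has all vertices of a face of another one shares this face. -/
lemma exists_faceVert_eq (hT : AffineIndependent ℝ T.vert) (hT' : AffineIndependent ℝ T'.vert)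
    {i : Fin (d + 1)} (h : T.faceVert i ⊆ Set.range T'.vert) :
    ∃ j, T'.faceVert j = T.faceVert i := by
  have hcard : (T.faceVert i).ncard = d := by
    rw [faceVert, Set.ncard_image_of_injective _ hT.injective, Set.ncard_compl]
    simp
  have hcard' : (Set.range T'.vert).ncard = d + 1 := by
    rw [← Set.image_univ, Set.ncard_image_of_injective _ hT'.injective]
    simp
  have hne : T.faceVert i ≠ Set.range T'.vert := by
    intro h
    rw [h] at hcard
    omega
  obtain ⟨_, ⟨j, rfl⟩, hj⟩ := Set.exists_of_ssubset (h.ssubset_of_ne hne)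
  refine ⟨j, ?_⟩
  symm
  refine Set.eq_of_subset_of_ncard_le ?_ ?_ ((Set.finite_range _).subset (Set.image_subset_range _ _))
  · intro y hy
    obtain ⟨k, rfl⟩ := h hy
    rw [vert_mem_faceVert_iff hT']
    rintro rfl
    exact hj hy
  · rw [hcard, faceVert, Set.ncard_image_of_injective _ hT'.injective, Set.ncard_compl]
    simp

/-- If two simplices share a face and lie on the same side of it, they have a common point off the
face: a point of `T` slightly off the barycentre of the face. -/
lemma exists_common_off_face (hd : d ≠ 0) (hT' : AffineIndependent ℝ T'.vert)
    {i j : Fin (d + 1)} (h : T'.faceVert j = T.faceVert i)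
    (hpos : 0 < (basis hT').coord j (T.vert i)) :
    ∃ y ∈ T.toSet ∩ T'.toSet, y ∉ T'.face j := by
  set x := T'.faceCenter j with hx
  have hxf : x ∈ T'.face j := faceCenter_mem_face hd T' j
  have hxT : x ∈ T.toSet := T.face_subset_toSet i (by rw [face, ← h]; exact hxf)
  let y : ℝ → Pt d := fun t => AffineMap.lineMap x (T.vert i) t
  have hcoord : ∀ k t, (basis hT').coord k (y t) =
      AffineMap.lineMap ((basis hT').coord k x) ((basis hT').coord k (T.vert i)) t :=
    fun k t => AffineMap.apply_lineMap _ _ _ _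
  have hev : ∀ᶠ t in 𝓝[>] (0 : ℝ), ∀ k, k ≠ j → 0 < (basis hT').coord k (y t) := by
    refine eventually_all.2 fun k => ?_
    by_cases hk : k = j
    · exact Eventually.of_forall fun t h => absurd hk h
    · have hc : ContinuousAt (fun t => (basis hT').coord k (y t)) 0 := by
        simp only [hcoord, AffineMap.lineMap_apply_ring]
        fun_prop
      have h0 : 0 < (basis hT').coord k (y 0) := by
        simpa [y] using coord_faceCenter_pos hT' hk
      exact ((hc.eventually (lt_mem_nhds h0)).filter_mono nhdsWithin_le_nhds).mono
        fun t ht _ => ht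
  have hlt : ∀ᶠ t in 𝓝[>] (0 : ℝ), t < 1 :=
    (eventually_lt_nhds one_pos).filter_mono nhdsWithin_le_nhds
  obtain ⟨t, ⟨h1, h2⟩, h3⟩ := ((hev.and hlt).and self_mem_nhdsWithin).exists
  have h3 : 0 < t := h3
  have hjt : 0 < (basis hT').coord j (y t) := by
    rw [hcoord, AffineMap.lineMap_apply_ring, coord_opposite_eq_zero hT' hxf]
    simpa using mul_pos h3 hpos
  refine ⟨y t, ⟨?_, ?_⟩, ?_⟩
  · exact T.convex_toSet.segment_subset hxT (T.vert_mem_toSet i)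
      (by rw [segment_eq_image_lineMap]; exact ⟨t, ⟨h3.le, h2.le⟩, rfl⟩)
  · rw [mem_toSet_iff hT']
    intro k
    by_cases hk : k = j
    · subst hk; exact hjt.le
    · exact (h1 k hk).le
  · intro hy
    exact hjt.ne' (coord_opposite_eq_zero hT' hy)

end TSimplex

open TSimplex

/-! ### Conforming families of simplices -/

section Conforming

variable {d : ℕ} {𝒯 : Mesh d} {T T' T'' : TSimplex d}

/-- Two distinct elements overlap in a null set, since they share at most `d` vertices. -/
lemma IsConforming.volume_inter_eq_zero (hc : IsConforming 𝒯)
    (hnd : ∀ T ∈ 𝒯, AffineIndependent ℝ T.vert) (hT : T ∈ 𝒯) (hT' : T' ∈ 𝒯) (hne : T ≠ T') :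
    volume (T.toSet ∩ T'.toSet) = 0 := by
  obtain ⟨hr, hi⟩ := hc T hT T' hT' hne
  rw [hi]
  have hnsub : ¬ Set.range T'.vert ⊆ Set.range T.vert := by
    intro hsub
    refine hr (Set.eq_of_subset_of_ncard_le hsub ?_ (Set.finite_range _)).symm
    rw [← Set.image_univ, ← Set.image_univ, Set.ncard_image_of_injective _ (hnd T hT).injective,
      Set.ncard_image_of_injective _ (hnd T' hT').injective]
  obtain ⟨_, ⟨k, rfl⟩, hk⟩ := Set.not_subset.1 hnsub
  refine measure_mono_null (convexHull_subset_affineSpan _)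
    (Measure.addHaar_affineSubspace volume _ ?_)
  intro htop
  have hsub : Set.range T.vert ∩ Set.range T'.vert ⊆ T'.vert '' {k}ᶜ := by
    rintro _ ⟨h1, ⟨l, rfl⟩⟩
    refine ⟨l, ?_, rfl⟩
    rintro rfl
    exact hk h1
  have hmem : T'.vert k ∈ affineSpan ℝ (T'.vert '' {k}ᶜ) :=
    affineSpan_mono ℝ hsub (by rw [htop]; trivial)
  exact (hnd T' hT').notMem_affineSpan_sdiff k Set.univ
    (by simpa [Set.compl_eq_univ_sdiff] using hmem)

/-- An element that contains the barycentre of a face of another element shares this face. -/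
lemma IsConforming.sharesFace_of_faceCenter_mem (hd : d ≠ 0) (hc : IsConforming 𝒯)
    (hnd : ∀ T ∈ 𝒯, AffineIndependent ℝ T.vert) (hT : T ∈ 𝒯) (hT' : T' ∈ 𝒯) (hne : T' ≠ T)
    {i : Fin (d + 1)} (hx : T.faceCenter i ∈ T'.toSet) : SharesFace T i T' := by
  refine ⟨hne, exists_faceVert_eq (hnd T hT) (hnd T' hT') ?_⟩
  have hmem : T.faceCenter i ∈ T.toSet ∩ T'.toSet :=
    ⟨T.face_subset_toSet i (faceCenter_mem_face hd T i), hx⟩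
  rw [(hc T hT T' hT' hne.symm).2] at hmem
  exact (faceVert_subset_of_faceCenter_mem (hnd T hT) Set.inter_subset_left hmem).trans
    Set.inter_subset_right

/-- Two elements that share a face lie on opposite sides of it. -/
lemma IsConforming.coord_neg (hd : d ≠ 0) (hc : IsConforming 𝒯)
    (hnd : ∀ T ∈ 𝒯, AffineIndependent ℝ T.vert) (hT : T ∈ 𝒯) (hT' : T' ∈ 𝒯) (hne : T ≠ T')
    {i j : Fin (d + 1)} (h : T'.faceVert j = T.faceVert i) :
    (basis (hnd T' hT')).coord j (T.vert i) < 0 := by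
  obtain ⟨hr, hi⟩ := hc T hT T' hT' hne
  have hi_notMem : T.vert i ∉ Set.range T'.vert := by
    rintro ⟨k, hk⟩
    by_cases hkj : k = j
    · subst hkj
      apply hr
      have e : ∀ (S : TSimplex d) (l : Fin (d + 1)),
          Set.range S.vert = insert (S.vert l) (S.faceVert l) := by
        intro S l
        rw [faceVert, ← Set.image_insert_eq, ← Set.image_univ]
        congr 1
        ext a
        simp [em]
      rw [e T i, e T' k, hk, h]
    · have hmem : T.vert i ∈ T.faceVert i := by
        rw [← h, ← hk]; exact (vert_mem_faceVert_iff (hnd T' hT')).2 hkj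
      exact (vert_mem_faceVert_iff (hnd T hT)).1 hmem rfl
  have hcommon : Set.range T.vert ∩ Set.range T'.vert ⊆ T'.faceVert j := by
    rintro _ ⟨⟨k, rfl⟩, hk⟩
    rw [h, vert_mem_faceVert_iff (hnd T hT)]
    rintro rfl
    exact hi_notMem hk
  refine lt_of_le_of_ne (not_lt.1 fun hpos => ?_) fun hzero => ?_
  · obtain ⟨y, hy, hyf⟩ := exists_common_off_face hd (hnd T' hT') h hpos
    rw [hi] at hy
    exact hyf (convexHull_mono hcommon hy)
  · -- otherwise all vertices of `T` lie in the hyperplane of the face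
    have hall : ∀ k, (basis (hnd T' hT')).coord j (T.vert k) = 0 := by
      intro k
      by_cases hk : k = i
      · rw [hk]; exact hzero
      · refine coord_opposite_eq_zero (hnd T' hT') (subset_convexHull _ _ ?_)
        rw [h]; exact (vert_mem_faceVert_iff (hnd T hT)).2 hk
    have heq : (basis (hnd T' hT')).coord j = AffineMap.const ℝ (Pt d) (0 : ℝ) := by
      refine AffineMap.ext_on (basis (hnd T hT)).tot ?_
      rintro _ ⟨k, rfl⟩
      simpa using hall k
    have := (basis (hnd T' hT')).coord_apply_eq j
    rw [heq] at this
    simp at this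

/-- A face of an element belongs to at most one other element: of three elements with a common
face, two would lie on the same side of it. -/
lemma IsConforming.sharesFace_unique (hd : d ≠ 0) (hc : IsConforming 𝒯)
    (hnd : ∀ T ∈ 𝒯, AffineIndependent ℝ T.vert) (hT : T ∈ 𝒯) (hT' : T' ∈ 𝒯) (hT'' : T'' ∈ 𝒯)
    {i : Fin (d + 1)} (h' : SharesFace T i T') (h'' : SharesFace T i T'') : T' = T'' := by
  by_contra hne
  obtain ⟨hn', j, hj⟩ := h'
  obtain ⟨hn'', k, hk⟩ := h''
  have h1 := hc.coord_neg hd hnd hT hT' hn'.symm hj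
  have h2 := hc.coord_neg hd hnd hT'' hT' (Ne.symm hne) (hj.trans hk.symm)
  have h3 := hc.coord_neg hd hnd hT'' hT hn'' hk.symm
  -- the coordinate functionals of `T` and `T'` vanishing on the face are proportional
  have heq : (basis (hnd T' hT')).coord j =
      (basis (hnd T' hT')).coord j (T.vert i) • (basis (hnd T hT)).coord i := by
    refine AffineMap.ext_on (basis (hnd T hT)).tot ?_
    rintro _ ⟨l, rfl⟩
    by_cases hl : l = i
    · subst hl
      have := (basis (hnd T hT)).coord_apply_eq l
      simp only [basis_apply] at this
      simp [this]
    · have hmem : T.vert l ∈ T.face i :=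
        subset_convexHull _ _ ((vert_mem_faceVert_iff (hnd T hT)).2 hl)
      have hmem' : T.vert l ∈ T'.face j := by rw [face, hj]; exact hmem
      simp [coord_opposite_eq_zero (hnd T hT) hmem, coord_opposite_eq_zero (hnd T' hT') hmem']
  have h4 := congrArg (fun a : Pt d →ᵃ[ℝ] ℝ => a (T''.vert k)) heq
  simp only [AffineMap.coe_smul, Pi.smul_apply, smul_eq_mul] at h4
  nlinarith

end Conforming

/-! ### Bisection -/

/-- Cutting a simplex through the midpoint of an edge `ab`. -/
lemma convexHull_insert_insert_midpoint {E : Type*} [AddCommGroup E] [Module ℝ E] (a b : E)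
    {W : Set E} (hW : W.Nonempty) :
    convexHull ℝ (insert a (insert b W)) =
      convexHull ℝ (insert a (insert (midpoint ℝ a b) W)) ∪
        convexHull ℝ (insert b (insert (midpoint ℝ a b) W)) := by
  have hm : midpoint ℝ a b ∈ convexHull ℝ (insert a (insert b W)) :=
    (convex_convexHull ℝ _).midpoint_mem (subset_convexHull _ _ (by simp))
      (subset_convexHull _ _ (by simp))
  have hhalf : ∀ (a b w x : E) (α β γ : ℝ), 0 ≤ β → 0 ≤ γ → β ≤ α → α + β + γ = 1 →
      x = α • a + β • b + γ • w → w ∈ convexHull ℝ W →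
      x ∈ convexHull ℝ (insert a (insert (midpoint ℝ a b) W)) := by
    intro a b w x α β γ hβ hγ hle hsum hx hw
    have hx' : x = (α - β) • a + (2 * β) • midpoint ℝ a b + γ • w := by
      rw [hx, midpoint_eq_smul_add]
      simp only [invOf_eq_inv]
      module
    have hconv := convex_convexHull ℝ (insert a (insert (midpoint ℝ a b) W))
    rw [hx']
    have := hconv.sum_mem (t := Finset.univ) (w := ![α - β, 2 * β, γ])
      (z := ![a, midpoint ℝ a b, w]) ?_ ?_ ?_
    · simpa [Fin.sum_univ_three] using this
    · intro i _
      fin_cases i <;> simp <;> linarith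
    · simp [Fin.sum_univ_three]; linarith
    · intro i _
      fin_cases i
      · exact subset_convexHull _ _ (by simp)
      · exact subset_convexHull _ _ (by simp)
      · exact convexHull_mono (fun y hy => by simp [hy]) hw
  refine Set.Subset.antisymm ?_ (Set.union_subset ?_ ?_)
  · intro x hx
    rw [convexHull_insert (Set.insert_nonempty _ _), convexHull_insert hW] at hx
    simp only [mem_convexJoin, Set.mem_singleton_iff, exists_eq_left] at hx
    obtain ⟨y, ⟨w, hw, hy⟩, hx⟩ := hx
    obtain ⟨p, q, hp, hq, hpq, rfl⟩ := hy
    obtain ⟨r, s, hr, hs, hrs, rfl⟩ := hx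
    rcases le_total (s * p) r with h | h
    · exact Or.inl (hhalf a b w _ r (s * p) (s * q) (by positivity) (by positivity) h
        (by rw [add_assoc, ← mul_add, hpq, mul_one, hrs]) (by module) hw)
    · right
      rw [midpoint_comm]
      exact hhalf b a w _ (s * p) r (s * q) (by positivity) (by positivity) h
        (by rw [add_comm (s * p), add_assoc, ← mul_add, hpq, mul_one, hrs]) (by module) hw
  · refine convexHull_min ?_ (convex_convexHull _ _)
    refine Set.insert_subset (subset_convexHull _ _ (by simp)) (Set.insert_subset hm ?_)
    exact fun y hy => subset_convexHull _ _ (by simp [hy])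
  · refine convexHull_min ?_ (convex_convexHull _ _)
    refine Set.insert_subset (subset_convexHull _ _ (by simp)) (Set.insert_subset hm ?_)
    exact fun y hy => subset_convexHull _ _ (by simp [hy])

namespace TSimplex

variable {d : ℕ} {T : TSimplex d}

/-- The vertices of a simplex and of its children in terms of the end points of the reference edge,
its midpoint and the set `W` of the remaining vertices. -/
lemma exists_range_vert_eq (hd : d = 2 ∨ d = 3) (T : TSimplex d) (hT : T.typ < d) :
    ∃ W : Set (Pt d), W.Nonempty ∧
      Set.range T.vert = insert (T.vert 0) (insert (T.vert (Fin.last d)) W) ∧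
      Set.range T.child₁.vert = insert (T.vert 0) (insert T.newVertex W) ∧
      Set.range T.child₂.vert = insert (T.vert (Fin.last d)) (insert T.newVertex W) := by
  obtain ⟨v, γ⟩ := T
  rcases hd with rfl | rfl
  · refine ⟨{v 1}, Set.singleton_nonempty _, ?_, ?_, ?_⟩
    · ext x; simp [Fin.exists_fin_succ, eq_comm]; grind
    · ext x; simp [Fin.exists_fin_succ, eq_comm, child₁, newVertex, Fin.ofNat]
    · simp only at hT
      interval_cases γ <;>
      · ext x; simp [Fin.exists_fin_succ, eq_comm, child₂, newVertex, Fin.ofNat]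
  · refine ⟨{v 1, v 2}, Set.insert_nonempty _ _, ?_, ?_, ?_⟩
    · ext x; simp [Fin.exists_fin_succ, eq_comm]; grind
    · ext x; simp [Fin.exists_fin_succ, eq_comm, child₁, newVertex, Fin.ofNat]
    · simp only at hT
      interval_cases γ <;> ext x <;>
        simp [Fin.exists_fin_succ, eq_comm, child₂, newVertex, Fin.ofNat]
      grind

lemma toSet_eq_union (hd : d = 2 ∨ d = 3) (T : TSimplex d) (hT : T.typ < d) :
    T.toSet = T.child₁.toSet ∪ T.child₂.toSet := by
  obtain ⟨W, hW, h0, h1, h2⟩ := exists_range_vert_eq hd T hT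
  rw [toSet, toSet, toSet, h0, h1, h2]
  exact convexHull_insert_insert_midpoint _ _ hW

lemma affineIndependent_of_range_subset (hT : AffineIndependent ℝ T.vert) {T' : TSimplex d}
    (h : Set.range T.vert ⊆ affineSpan ℝ (Set.range T'.vert)) : AffineIndependent ℝ T'.vert := by
  have htop : affineSpan ℝ (Set.range T'.vert) = ⊤ := by
    have h1 : affineSpan ℝ (Set.range T.vert) = ⊤ := (basis hT).tot
    rw [eq_top_iff, ← h1]
    exact affineSpan_le.2 h
  rw [affineIndependent_iff_finrank_vectorSpan_eq ℝ T'.vert (n := d) (by simp),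
    ← direction_affineSpan, htop, AffineSubspace.direction_top, finrank_top]
  simp

lemma affineIndependent_child (hd : d = 2 ∨ d = 3) (hT : T.typ < d)
    (hnd : AffineIndependent ℝ T.vert) :
    AffineIndependent ℝ T.child₁.vert ∧ AffineIndependent ℝ T.child₂.vert := by
  obtain ⟨W, hW, h0, h1, h2⟩ := exists_range_vert_eq hd T hT
  -- the second end point of the reference edge is on the line through the first one and the midpoint
  have hline : ∀ a b : Pt d, b ∈ affineSpan ℝ (insert a (insert (midpoint ℝ a b) W)) := by
    intro a b
    have ha : a ∈ affineSpan ℝ (insert a (insert (midpoint ℝ a b) W)) :=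
      subset_affineSpan _ _ (by simp)
    have hm : midpoint ℝ a b ∈ affineSpan ℝ (insert a (insert (midpoint ℝ a b) W)) :=
      subset_affineSpan _ _ (by simp)
    have := AffineMap.lineMap_mem (2 : ℝ) ha hm
    convert this using 1
    rw [AffineMap.lineMap_apply_module, midpoint_eq_smul_add]
    simp only [invOf_eq_inv]
    module
  constructor <;> refine affineIndependent_of_range_subset hnd ?_
  · rw [h0, h1]
    refine Set.insert_subset (subset_affineSpan _ _ (by simp)) (Set.insert_subset (hline _ _) ?_)
    exact fun y hy => subset_affineSpan _ _ (by simp [hy])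
  · rw [h0, h2, newVertex, midpoint_comm]
    refine Set.insert_subset (hline _ _) (Set.insert_subset (subset_affineSpan _ _ (by simp)) ?_)
    exact fun y hy => subset_affineSpan _ _ (by simp [hy])

end TSimplex

/-! ### Refinements -/

/-- `𝒯'` is a refinement of `𝒯` as a decomposition: its elements are parts of elements of `𝒯`, and
each element of `𝒯` is the union of the elements of `𝒯'` inside it. -/
structure Refines {d : ℕ} (𝒯 𝒯' : Mesh d) : Prop where
  exists_parent : ∀ T' ∈ 𝒯', ∃ T ∈ 𝒯, T'.toSet ⊆ T.toSet
  exists_part : ∀ T ∈ 𝒯, ∀ x ∈ T.toSet, ∃ T' ∈ 𝒯', x ∈ T'.toSet ∧ T'.toSet ⊆ T.toSet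

section Refinement

variable {d : ℕ} {𝒯 𝒯' 𝒯'' : Mesh d}

lemma Refines.refl (𝒯 : Mesh d) : Refines 𝒯 𝒯 :=
  ⟨fun T hT => ⟨T, hT, subset_rfl⟩, fun T hT _ hx => ⟨T, hT, hx, subset_rfl⟩⟩

lemma Refines.trans (h : Refines 𝒯 𝒯') (h' : Refines 𝒯' 𝒯'') : Refines 𝒯 𝒯'' := by
  constructor
  · intro T'' hT''
    obtain ⟨T', hT', hs'⟩ := h'.exists_parent T'' hT''
    obtain ⟨T, hT, hs⟩ := h.exists_parent T' hT'
    exact ⟨T, hT, hs'.trans hs⟩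
  · intro T hT x hx
    obtain ⟨T', hT', hx', hs'⟩ := h.exists_part T hT x hx
    obtain ⟨T'', hT'', hx'', hs''⟩ := h'.exists_part T' hT' x hx'
    exact ⟨T'', hT'', hx'', hs''.trans hs'⟩

lemma Refines.iUnion_eq (h : Refines 𝒯 𝒯') : ⋃ T ∈ 𝒯', T.toSet = ⋃ T ∈ 𝒯, T.toSet := by
  refine Set.Subset.antisymm ?_ ?_
  · refine Set.iUnion₂_subset fun T' hT' => ?_
    obtain ⟨T, hT, hs⟩ := h.exists_parent T' hT'
    exact hs.trans (Set.subset_biUnion_of_mem (u := fun T : TSimplex d => T.toSet) hT)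
  · refine Set.iUnion₂_subset fun T hT x hx => ?_
    obtain ⟨T', hT', hx', -⟩ := h.exists_part T hT x hx
    exact Set.mem_iUnion₂.2 ⟨T', hT', hx'⟩

lemma mem_bisect {M : Mesh d} {T' : TSimplex d} :
    T' ∈ bisect 𝒯 M ↔ (T' ∈ 𝒯 ∧ T' ∉ M) ∨ ∃ T ∈ M, T' = T.child₁ ∨ T' = T.child₂ := by
  simp [bisect]

lemma refines_bisect (hd : d = 2 ∨ d = 3) (h𝒯 : ∀ T ∈ 𝒯, T.typ < d) {M : Mesh d} (hM : M ⊆ 𝒯) :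
    Refines 𝒯 (bisect 𝒯 M) := by
  constructor
  · intro T' hT'
    rw [mem_bisect] at hT'
    obtain ⟨hT', -⟩ | ⟨T, hT, rfl | rfl⟩ := hT'
    · exact ⟨T', hT', subset_rfl⟩
    · exact ⟨T, hM hT, by rw [T.toSet_eq_union hd (h𝒯 T (hM hT))]; exact Set.subset_union_left⟩
    · exact ⟨T, hM hT, by rw [T.toSet_eq_union hd (h𝒯 T (hM hT))]; exact Set.subset_union_right⟩
  · intro T hT x hx
    by_cases hTM : T ∈ M
    · have hx' := hx
      rw [T.toSet_eq_union hd (h𝒯 T hT)] at hx' ⊢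
      rcases hx' with hx' | hx'
      · exact ⟨_, mem_bisect.2 (Or.inr ⟨T, hTM, Or.inl rfl⟩), hx', Set.subset_union_left⟩
      · exact ⟨_, mem_bisect.2 (Or.inr ⟨T, hTM, Or.inr rfl⟩), hx', Set.subset_union_right⟩
    · exact ⟨T, mem_bisect.2 (Or.inl ⟨hT, hTM⟩), hx, subset_rfl⟩

/-- A property of tagged simplices that passes to both children. -/
def Hereditary (P : TSimplex d → Prop) : Prop := ∀ T, P T → P T.child₁ ∧ P T.child₂

lemma Hereditary.bisect {P : TSimplex d → Prop} (hP : Hereditary P) {M : Mesh d} (hM : M ⊆ 𝒯)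
    (h : ∀ T ∈ 𝒯, P T) : ∀ T ∈ bisect 𝒯 M, P T := by
  intro T' hT'
  rw [mem_bisect] at hT'
  obtain ⟨hT', -⟩ | ⟨T, hT, rfl | rfl⟩ := hT'
  · exact h _ hT'
  · exact (hP _ (h _ (hM hT))).1
  · exact (hP _ (h _ (hM hT))).2

lemma IsNVB.hereditary_and_refines (hd : d = 2 ∨ d = 3) {M : Mesh d} (hM : M ⊆ 𝒯)
    (h : IsNVB 𝒯 M 𝒯') {P : TSimplex d → Prop} (hP : Hereditary P) (htyp : ∀ T, P T → T.typ < d)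
    (h𝒯 : ∀ T ∈ 𝒯, P T) : (∀ T ∈ 𝒯', P T) ∧ Refines 𝒯 𝒯' := by
  classical
  obtain ⟨⟨n, rfl⟩, -, -⟩ := h
  induction n with
  | zero =>
    exact ⟨hP.bisect hM h𝒯, refines_bisect hd (fun T hT => htyp T (h𝒯 T hT)) hM⟩
  | succ n ih =>
    rw [Function.iterate_succ_apply']
    refine ⟨hP.bisect (Finset.filter_subset _ _) ih.1, ih.2.trans ?_⟩
    exact refines_bisect hd (fun T hT => htyp T (ih.1 T hT)) (Finset.filter_subset _ _)

/-- Hereditary properties of the initial elements pass to all meshes created by newest vertex bisection;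
these meshes are conforming and refine the initial one. -/
lemma refinements_induction (hd : d = 2 ∨ d = 3) {P : TSimplex d → Prop} (hP : Hereditary P)
    (htyp : ∀ T, P T → T.typ < d) (h𝒯 : ∀ T ∈ 𝒯, P T) (hc : IsConforming 𝒯)
    (h : 𝒯' ∈ refinements 𝒯) : (∀ T ∈ 𝒯', P T) ∧ IsConforming 𝒯' ∧ Refines 𝒯 𝒯' := by
  change Relation.ReflTransGen _ _ _ at h
  induction h with
  | refl => exact ⟨h𝒯, hc, Refines.refl _⟩
  | tail _ hstep ih =>
    obtain ⟨M, hM, hN⟩ := hstep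
    have := hN.hereditary_and_refines hd hM hP htyp ih.1
    exact ⟨this.1, hN.2.2, ih.2.2.trans this.2⟩

end Refinement

/-! ### Finitely many shapes -/

/-- The tagged simplex of type `γ` (with first vertex `0`) which the vectors `e₁, …, e_d` span: with
`sₖ = e₁ + ⋯ + eₖ`, its vertices are `0, s_{d-γ+1}/2, …, s_d/2, s₁, …, s_{d-γ}`. For type `0` it is
the Kuhn simplex of the parallelotope spanned by the vectors, and bisection leads through the types
`1, …, d-1` to a Kuhn simplex of half the size. -/
def frameVert {d : ℕ} (γ : ℕ) (e : Fin d → Pt d) (i : Fin (d + 1)) : Pt d :=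
  if i = 0 then 0
  else if i.val ≤ γ then (1 / 2 : ℝ) • ∑ j : Fin d, if j.val < d - γ + i.val then e j else 0
  else ∑ j : Fin d, if j.val < i.val - γ then e j else 0

section Shapes

variable {d : ℕ} {T : TSimplex d}

/-- Every tagged simplex is of the form `frameVert`, up to a translation. -/
lemma exists_frame (hd : d = 2 ∨ d = 3) (T : TSimplex d) (hT : T.typ < d) :
    ∃ e : Fin d → Pt d, ∀ i, T.vert i = T.vert 0 + frameVert T.typ e i := by
  obtain ⟨v, γ⟩ := T
  rcases hd with rfl | rfl
  · simp only at hT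
    interval_cases γ
    · refine ⟨![v 1 - v 0, v 2 - v 1], fun i => ?_⟩
      fin_cases i <;> simp [frameVert, Fin.sum_univ_succ]
    · refine ⟨![v 2 - v 0, (2 : ℝ) • (v 1 - v 0) - (v 2 - v 0)], fun i => ?_⟩
      fin_cases i <;> simp [frameVert, Fin.sum_univ_succ]
  · simp only at hT
    interval_cases γ
    · refine ⟨![v 1 - v 0, v 2 - v 1, v 3 - v 2], fun i => ?_⟩
      fin_cases i <;> simp [frameVert, Fin.sum_univ_succ]
    · refine ⟨![v 2 - v 0, v 3 - v 2, (2 : ℝ) • (v 1 - v 0) - (v 3 - v 0)], fun i => ?_⟩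
      fin_cases i <;> simp [frameVert, Fin.sum_univ_succ]
      module
    · refine ⟨![v 3 - v 0, (2 : ℝ) • (v 1 - v 0) - (v 3 - v 0),
        (2 : ℝ) • (v 2 - v 0) - (2 : ℝ) • (v 1 - v 0)], fun i => ?_⟩
      fin_cases i <;> simp [frameVert, Fin.sum_univ_succ]

/-- The first child has the frame of its parent, halved if its type is `0`. -/
lemma child₁_vert_eq (hd : d = 2 ∨ d = 3) (hT : T.typ < d) {z : Pt d} {c : ℝ} {e : Fin d → Pt d}
    (h : ∀ i, T.vert i = z + c • frameVert T.typ e i) (i : Fin (d + 1)) :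
    T.child₁.vert i =
      z + (if T.typ + 1 = d then c / 2 else c) • frameVert T.child₁.typ e i := by
  obtain ⟨v, γ⟩ := T
  simp only at hT h
  rcases hd with rfl | rfl
  · interval_cases γ <;> fin_cases i <;>
      simp [frameVert, Fin.sum_univ_succ, child₁, newVertex, midpoint_eq_smul_add, h, Fin.ofNat] <;>
      module
  · interval_cases γ <;> fin_cases i <;>
      simp [frameVert, Fin.sum_univ_succ, child₁, newVertex, midpoint_eq_smul_add, h, Fin.ofNat] <;>
      module

/-- The frame of the second child, seen from the other end of the reference edge, consists of the
same vectors up to order and sign, halved if its type is `0`. -/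
lemma child₂_vert_eq (hd : d = 2 ∨ d = 3) (hT : T.typ < d) {z : Pt d} {c : ℝ} {e : Fin d → Pt d}
    (h : ∀ i, T.vert i = z + c • frameVert T.typ e i) :
    ∃ e' : Fin d → Pt d, (∀ j, ∃ i, e' j = e i ∨ e' j = - e i) ∧ ∀ i, T.child₂.vert i =
      T.vert (Fin.last d) +
        (if T.typ + 1 = d then c / 2 else c) • frameVert T.child₂.typ e' i := by
  obtain ⟨v, γ⟩ := T
  simp only at hT h
  rcases hd with rfl | rfl
  · interval_cases γ
    · refine ⟨![-e 1, -e 0], ?_, fun i => ?_⟩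
      · intro j; fin_cases j <;> simp [Fin.exists_fin_succ]
      fin_cases i <;>
      simp [frameVert, Fin.sum_univ_succ, child₂, newVertex, midpoint_eq_smul_add, h, Fin.ofNat] <;>
      module
    · refine ⟨![-e 0, e 1], ?_, fun i => ?_⟩
      · intro j; fin_cases j <;> simp [Fin.exists_fin_succ]
      fin_cases i <;>
      simp [frameVert, Fin.sum_univ_succ, child₂, newVertex, midpoint_eq_smul_add, h, Fin.ofNat] <;>
      module
  · interval_cases γ
    · refine ⟨![-e 2, -e 1, -e 0], ?_, fun i => ?_⟩
      · intro j; fin_cases j <;> simp [Fin.exists_fin_succ]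
      fin_cases i <;>
      simp [frameVert, Fin.sum_univ_succ, child₂, newVertex, midpoint_eq_smul_add, h, Fin.ofNat] <;>
      module
    · refine ⟨![-e 1, -e 0, e 2], ?_, fun i => ?_⟩
      · intro j; fin_cases j <;> simp [Fin.exists_fin_succ]
      fin_cases i <;>
      simp [frameVert, Fin.sum_univ_succ, child₂, newVertex, midpoint_eq_smul_add, h, Fin.ofNat] <;>
      module
    · refine ⟨![-e 0, e 1, e 2], ?_, fun i => ?_⟩
      · intro j; fin_cases j <;> simp [Fin.exists_fin_succ]
      fin_cases i <;>
      simp [frameVert, Fin.sum_univ_succ, child₂, newVertex, midpoint_eq_smul_add, h, Fin.ofNat] <;>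
      module

/-- The simplices that are translated copies, shrunk by a power of `2`, of the simplices with frame
vectors in `𝓔`. -/
structure HasFrameIn (𝓔 : Set (Pt d)) (T : TSimplex d) : Prop where
  typ_lt : T.typ < d
  nondegenerate : AffineIndependent ℝ T.vert
  exists_frame : ∃ (n : ℕ) (z : Pt d) (e : Fin d → Pt d), (∀ j, e j ∈ 𝓔) ∧
    ∀ i, T.vert i = z + ((1 / 2 : ℝ) ^ n) • frameVert T.typ e i

lemma hereditary_hasFrameIn (hd : d = 2 ∨ d = 3) {𝓔 : Set (Pt d)} (h𝓔 : ∀ e ∈ 𝓔, -e ∈ 𝓔) :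
    Hereditary (HasFrameIn 𝓔) := by
  rintro T ⟨hT, hnd, n, z, e, he, hv⟩
  have hd0 : 0 < d := by omega
  have hscale : ∃ m : ℕ, (if T.typ + 1 = d then (1 / 2 : ℝ) ^ n / 2 else (1 / 2 : ℝ) ^ n) =
      (1 / 2 : ℝ) ^ m := by
    split_ifs
    · exact ⟨n + 1, by rw [pow_succ]; ring⟩
    · exact ⟨n, rfl⟩
  obtain ⟨m, hm⟩ := hscale
  obtain ⟨hnd₁, hnd₂⟩ := affineIndependent_child hd hT hnd
  refine ⟨⟨Nat.mod_lt _ hd0, hnd₁, m, z, e, he, ?_⟩, ⟨Nat.mod_lt _ hd0, hnd₂, ?_⟩⟩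
  · intro i
    rw [child₁_vert_eq hd hT hv i, hm]
  · obtain ⟨e', he', hv'⟩ := child₂_vert_eq hd hT hv
    refine ⟨m, T.vert (Fin.last d), e', fun j => ?_, fun i => ?_⟩
    · obtain ⟨i, h | h⟩ := he' j
      · rw [h]; exact he i
      · rw [h]; exact h𝓔 _ (he i)
    · rw [hv' i, hm]

/-- The frame vectors of the elements of a mesh, together with their negatives, are finitely many.
Hence so are the shapes of all simplices obtained from the mesh by bisection. -/
lemma exists_finite_frames (hd : d = 2 ∨ d = 3) {𝒯 : Mesh d}
    (hnd : ∀ T ∈ 𝒯, AffineIndependent ℝ T.vert) (htyp : ∀ T ∈ 𝒯, T.typ < d) :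
    ∃ 𝓔 : Set (Pt d), 𝓔.Finite ∧ (∀ e ∈ 𝓔, -e ∈ 𝓔) ∧ ∀ T ∈ 𝒯, HasFrameIn 𝓔 T := by
  choose! e he using fun (T : TSimplex d) (hT : T.typ < d) => exists_frame hd T hT
  let 𝓐 : Set (Pt d) := ⋃ T ∈ 𝒯, Set.range (e T)
  have hfin : 𝓐.Finite := 𝒯.finite_toSet.biUnion fun T _ => Set.finite_range _
  refine ⟨𝓐 ∪ Neg.neg '' 𝓐, hfin.union (hfin.image _), ?_, ?_⟩
  · rintro x (hx | ⟨y, hy, rfl⟩)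
    · exact Or.inr ⟨x, hx, rfl⟩
    · left; simpa using hy
  · intro T hT
    refine ⟨htyp T hT, hnd T hT, 0, T.vert 0, e T, fun j => Or.inl ?_, fun i => ?_⟩
    · exact Set.mem_iUnion₂.2 ⟨T, hT, j, rfl⟩
    · rw [pow_zero, one_smul]
      exact he T (htyp T hT) i

end Shapes

/-! ### Shape regularity -/

section Scaling

open scoped Pointwise

variable {d : ℕ}

/-- The closed simplices of dimension `m` have finite `m`-dimensional Hausdorff measure. -/
lemma euclideanHausdorffMeasure_convexHull_range_lt_top {m : ℕ} (w : Fin (m + 1) → Pt d) :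
    (μHE[m] : Measure (Pt d)) (convexHull ℝ (Set.range w)) < ⊤ := by
  let L : (Fin m → ℝ) →L[ℝ] Pt d :=
    LinearMap.toContinuousLinearMap
      (Fintype.linearCombination ℝ (fun j : Fin m => w j.succ - w 0))
  let f : (Fin m → ℝ) → Pt d := fun x => w 0 + L x
  have hf : LipschitzWith ‖L‖₊ f := by
    have := L.lipschitz
    intro x y
    simpa [f] using this x y
  have hsub : convexHull ℝ (Set.range w) ⊆ f '' Set.Icc 0 1 := by
    refine convexHull_min ?_ ?_
    · rintro _ ⟨k, rfl⟩
      refine Fin.cases ⟨0, by simp, by simp [f]⟩ (fun j => ?_) k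
      refine ⟨Pi.single j 1, ⟨by simp, fun i => ?_⟩, ?_⟩
      · rw [Pi.single_apply]; split_ifs <;> simp
      simp [f, L, Fintype.linearCombination_apply_single]
    · have : f = fun x => (w 0) + L.toLinearMap x := rfl
      have h2 : f '' Set.Icc 0 1 = w 0 +ᵥ (L.toLinearMap '' Set.Icc 0 1) := by
        rw [this, ← Set.image_vadd, Set.image_image]; rfl
      rw [h2]
      exact ((convex_Icc _ _).linear_image _).vadd _
  have hfin : (μH[m] : Measure (Pt d)) (f '' Set.Icc 0 1) < ⊤ := by
    refine (hf.hausdorffMeasure_image_le (Nat.cast_nonneg m) _).trans_lt ?_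
    have : (μH[m] : Measure (Fin m → ℝ)) = volume := by
      simpa using hausdorffMeasure_pi_real (ι := Fin m)
    rw [this]
    refine ENNReal.mul_lt_top ?_ isCompact_Icc.measure_lt_top
    exact ENNReal.rpow_lt_top_of_nonneg (Nat.cast_nonneg m) ENNReal.coe_ne_top
  refine (measure_mono hsub).trans_lt ?_
  rw [MeasureTheory.Measure.euclideanHausdorffMeasure_def, Measure.smul_apply]
  exact ENNReal.mul_lt_top ENNReal.coe_lt_top hfin

lemma surf_face_lt_top (hd : d ≠ 0) (T : TSimplex d) (i : Fin (d + 1)) :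
    surf d (T.face i) < ⊤ := by
  obtain ⟨m, rfl⟩ := Nat.exists_eq_succ_of_ne_zero hd
  have : T.faceVert i = Set.range (fun k => T.vert (i.succAbove k)) := by
    rw [faceVert, ← Fin.range_succAbove, ← Set.range_comp]; rfl
  rw [face, this]
  exact euclideanHausdorffMeasure_convexHull_range_lt_top _

variable {T V : TSimplex d} {z : Pt d} {h : ℝ}

lemma convexHull_image_vert (hv : ∀ i, T.vert i = z + h • V.vert i) (s : Set (Fin (d + 1))) :
    convexHull ℝ (T.vert '' s) = z +ᵥ (h • convexHull ℝ (V.vert '' s)) := by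
  rw [← convexHull_smul, ← convexHull_vadd]
  congr 1
  ext x
  simp only [Set.mem_image, Set.mem_vadd_set, Set.mem_smul_set]
  constructor
  · rintro ⟨i, hi, rfl⟩
    exact ⟨h • V.vert i, ⟨V.vert i, ⟨i, hi, rfl⟩, rfl⟩, (hv i).symm⟩
  · rintro ⟨_, ⟨_, ⟨i, hi, rfl⟩, rfl⟩, rfl⟩
    exact ⟨i, hi, hv i⟩

lemma vol_of_scaling (hh : 0 < h) (hv : ∀ i, T.vert i = z + h • V.vert i) :
    T.vol = h ^ d * V.vol := by
  have := convexHull_image_vert hv Set.univ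
  rw [Set.image_univ, Set.image_univ] at this
  rw [vol, toSet, this, measure_vadd, Measure.addHaar_smul, ENNReal.toReal_mul, vol, toSet]
  simp [hh.le, abs_of_pos hh]

lemma surf_of_scaling (hh : 0 < h) (hv : ∀ i, T.vert i = z + h • V.vert i) (i : Fin (d + 1)) :
    (surf d (T.face i)).toReal = h ^ (d - 1) * (surf d (V.face i)).toReal := by
  have := convexHull_image_vert hv {i}ᶜ
  rw [face, faceVert, this, surf, measure_vadd, Measure.euclideanHausdorffMeasure_smul₀ _ hh.ne',
    face, faceVert, ENNReal.smul_def, smul_eq_mul, ENNReal.toReal_mul]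
  simp [abs_of_pos hh]

lemma dist_of_scaling (hh : 0 < h) (hv : ∀ i, T.vert i = z + h • V.vert i) (i j : Fin (d + 1)) :
    dist (T.vert i) (T.vert j) = h * dist (V.vert i) (V.vert j) := by
  rw [hv, hv, dist_add_left, dist_smul₀, Real.norm_of_nonneg hh.le]

lemma affineIndependent_of_scaling (hT : AffineIndependent ℝ T.vert)
    (hv : ∀ i, T.vert i = z + h • V.vert i) : AffineIndependent ℝ V.vert := by
  let f : Pt d →ᵃ[ℝ] Pt d := AffineMap.const ℝ _ z + h • AffineMap.id ℝ _
  refine AffineIndependent.of_comp f ?_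
  convert hT using 1
  ext1 i
  simp [f, hv]

end Scaling

/-- `T` is `K`-shape regular of size `h`: its volume, the lengths of its edges and the surface
measures of its faces are comparable with the respective powers of `h`. -/
structure IsShapeRegular {d : ℕ} (K h : ℝ) (T : TSimplex d) : Prop where
  pow_le_vol : h ^ d ≤ K * T.vol
  vol_le : T.vol ≤ K * h ^ d
  le_dist : ∀ i j, i ≠ j → h ≤ K * dist (T.vert i) (T.vert j)
  dist_le : ∀ i j, dist (T.vert i) (T.vert j) ≤ K * h
  surf_le : ∀ i, (surf d (T.face i)).toReal ≤ K * h ^ (d - 1)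

section

variable {d : ℕ}

/-- Each shape is shape regular, uniformly with respect to its translated and scaled copies. -/
lemma eventually_isShapeRegular (V : TSimplex d) : ∀ᶠ K : ℝ in atTop, ∀ (T : TSimplex d) (z : Pt d)
    (h : ℝ), 0 < h → AffineIndependent ℝ T.vert → (∀ i, T.vert i = z + h • V.vert i) →
    IsShapeRegular K h T := by
  have h1 := eventually_ge_atTop (V.vol)⁻¹
  have h2 := eventually_ge_atTop V.vol
  have h3 : ∀ᶠ K : ℝ in atTop, ∀ i j, (dist (V.vert i) (V.vert j))⁻¹ ≤ K :=
    eventually_all.2 fun i => eventually_all.2 fun j => eventually_ge_atTop _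
  have h4 : ∀ᶠ K : ℝ in atTop, ∀ i j, dist (V.vert i) (V.vert j) ≤ K :=
    eventually_all.2 fun i => eventually_all.2 fun j => eventually_ge_atTop _
  have h5 : ∀ᶠ K : ℝ in atTop, ∀ i, (surf d (V.face i)).toReal ≤ K :=
    eventually_all.2 fun i => eventually_ge_atTop _
  filter_upwards [h1, h2, h3, h4, h5] with K h1 h2 h3 h4 h5 T z h hh hT hv
  have hV := affineIndependent_of_scaling hT hv
  constructor
  · rw [vol_of_scaling hh hv, mul_left_comm]
    refine le_mul_of_one_le_right (by positivity) ?_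
    rwa [inv_le_iff_one_le_mul₀ (vol_pos hV)] at h1
  · rw [vol_of_scaling hh hv, mul_comm]
    gcongr
  · intro i j hij
    rw [dist_of_scaling hh hv, mul_left_comm]
    refine le_mul_of_one_le_right hh.le ?_
    have := h3 i j
    rwa [inv_le_iff_one_le_mul₀ (dist_pos.2 (hV.injective.ne hij))] at this
  · intro i j
    rw [dist_of_scaling hh hv, mul_comm]
    exact mul_le_mul_of_nonneg_right (h4 i j) hh.le
  · intro i
    rw [surf_of_scaling hh hv, mul_comm]
    exact mul_le_mul_of_nonneg_right (h5 i) (by positivity)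

lemma exists_isShapeRegular {𝓔 : Set (Pt d)} (h𝓔 : 𝓔.Finite) :
    ∃ K : ℝ, 1 ≤ K ∧ ∀ T, HasFrameIn 𝓔 T → ∃ h, 0 < h ∧ h ≤ 1 ∧ IsShapeRegular K h T := by
  let 𝓥 : Set (TSimplex d) :=
    ⋃ γ ∈ Set.Iio d, (fun e => ⟨frameVert γ e, γ⟩) '' Set.univ.pi fun _ => 𝓔
  have hfin : 𝓥.Finite :=
    (Set.finite_Iio d).biUnion fun γ _ => (Set.Finite.pi' fun _ => h𝓔).image _ |>.subset (by
      apply Set.image_mono; intro e he; simpa using he)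
  have := (eventually_all_finite hfin).2 fun V _ => eventually_isShapeRegular V
  obtain ⟨K, hK, hK1⟩ := (this.and (eventually_ge_atTop 1)).exists
  refine ⟨K, hK1, ?_⟩
  rintro T ⟨hT, hnd, n, z, e, he, hv⟩
  refine ⟨(1 / 2) ^ n, by positivity, pow_le_one₀ (by norm_num) (by norm_num), ?_⟩
  refine hK ⟨frameVert T.typ e, T.typ⟩ ?_ T z _ (by positivity) hnd hv
  exact Set.mem_iUnion₂.2 ⟨T.typ, hT, e, fun j _ => he j, rfl⟩

/-- The weight `|T|^{1/2} |E|` of a face residual is controlled by the volume of each of the two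
elements at the face. -/
lemma IsShapeRegular.sqrt_vol_mul_surf_le (hd : 2 ≤ d) {K h h' : ℝ} (hK : 1 ≤ K) (hh : 0 < h)
    (hh1 : h ≤ 1) {T T' : TSimplex d} (hT : IsShapeRegular K h T)
    (hT' : IsShapeRegular K h' T') {i j : Fin (d + 1)}
    (hface : T'.faceVert j = T.faceVert i) :
    Real.sqrt T.vol * (surf d (T.face i)).toReal ≤ K ^ (2 * d + 3) * T'.vol := by
  -- the two elements have an edge in common, hence comparable sizes
  have hle : h ≤ K ^ 2 * h' := by
    have hcard : 1 < ({i}ᶜ : Finset (Fin (d + 1))).card := by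
      rw [Finset.card_compl]; simp; omega
    obtain ⟨k, hk, l, hl, hkl⟩ := Finset.one_lt_card.1 hcard
    simp only [Finset.mem_compl, Finset.mem_singleton] at hk hl
    have hk' : T.vert k ∈ T'.faceVert j := by rw [hface]; exact ⟨k, hk, rfl⟩
    have hl' : T.vert l ∈ T'.faceVert j := by rw [hface]; exact ⟨l, hl, rfl⟩
    obtain ⟨k', -, hk'⟩ := hk'
    obtain ⟨l', -, hl'⟩ := hl'
    calc h ≤ K * dist (T.vert k) (T.vert l) := hT.le_dist k l hkl
      _ = K * dist (T'.vert k') (T'.vert l') := by rw [hk', hl']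
      _ ≤ K * (K * h') := by gcongr; exact hT'.dist_le _ _
      _ = K ^ 2 * h' := by ring
  have hsqrt : Real.sqrt T.vol ≤ K * h := by
    refine Real.sqrt_le_iff.2 ⟨by positivity, hT.vol_le.trans ?_⟩
    rw [mul_pow]
    have h1 : h ^ d ≤ h ^ 2 := pow_le_pow_of_le_one hh.le hh1 hd
    have h2 : K ≤ K ^ 2 := le_self_pow₀ hK two_ne_zero
    gcongr
  calc Real.sqrt T.vol * (surf d (T.face i)).toReal
      ≤ (K * h) * (K * h ^ (d - 1)) := by
        gcongr
        exact hT.surf_le i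
    _ = K ^ 2 * h ^ d := by
        obtain ⟨m, rfl⟩ : ∃ m, d = m + 1 := ⟨d - 1, by omega⟩
        simp only [Nat.add_sub_cancel]; ring
    _ ≤ K ^ 2 * (K ^ 2 * h') ^ d := by gcongr
    _ = K ^ (2 * d + 2) * h' ^ d := by rw [mul_pow]; ring
    _ ≤ K ^ (2 * d + 2) * (K * T'.vol) := by gcongr; exact hT'.pow_le_vol
    _ = K ^ (2 * d + 3) * T'.vol := by ring

end

/-! ### Discrete stresses are piecewise constant -/

section Analysis

variable {d : ℕ} {Ω : Set (Pt d)}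

open scoped Pointwise in
/-- A Lipschitz boundary is a null set: locally it is a graph, and a graph has infinitely many
disjoint translates within a bounded distance. -/
lemma HasLipschitzBoundary.volume_frontier (hΩ : HasLipschitzBoundary Ω) :
    volume (frontier Ω) = 0 := by
  refine measure_null_of_locally_null _ fun x hx => ?_
  obtain ⟨U, hU, hxU, e, he, K, φ, hφ, hgraph⟩ := hΩ x hx
  refine ⟨U ∩ frontier Ω, inter_mem (mem_nhdsWithin_of_mem_nhds (hU.mem_nhds hxU))
    self_mem_nhdsWithin, ?_⟩
  have hee : ⟪e, e⟫ = 1 := by rw [real_inner_self_eq_norm_sq, he, one_pow]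
  have hc1 : Continuous fun y : Pt d => φ (y - ⟪e, y⟫ • e) :=
    hφ.continuous.comp (by fun_prop)
  have hc2 : Continuous fun y : Pt d => ⟪e, y⟫ := by fun_prop
  let Γ : Set (Pt d) := {y | φ (y - ⟪e, y⟫ • e) = ⟪e, y⟫}
  have hΓ : MeasurableSet Γ := (isClosed_eq hc1 hc2).measurableSet
  have hsub : U ∩ frontier Ω ⊆ Γ := by
    rintro y ⟨hyU, hy⟩
    by_contra hne
    rcases lt_or_gt_of_ne hne with hlt | hgt
    · refine hy.2 (mem_interior.2 ⟨U ∩ {y | φ (y - ⟪e, y⟫ • e) < ⟪e, y⟫}, ?_,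
        hU.inter (isOpen_lt hc1 hc2), hyU, hlt⟩)
      exact fun w hw => (hgraph w hw.1).2 hw.2
    · have hopen : IsOpen (U ∩ {y | ⟪e, y⟫ < φ (y - ⟪e, y⟫ • e)}) :=
        hU.inter (isOpen_lt hc2 hc1)
      obtain ⟨w, ⟨hwU, hw⟩, hwΩ⟩ := mem_closure_iff.1 hy.1 _ hopen ⟨hyU, hgt⟩
      exact lt_asymm hw ((hgraph w hwU).1 hwΩ)
  refine measure_mono_null hsub ?_
  let u : ℕ → Pt d := fun n => (1 / ((n : ℝ) + 1)) • e
  refine Measure.addHaar_eq_zero_of_disjoint_translates volume u ?_ ?_ hΓ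
  · refine isBounded_iff_forall_norm_le.2 ⟨1, ?_⟩
    rintro _ ⟨n, rfl⟩
    simp only [u]
    rw [norm_smul, he, mul_one, Real.norm_of_nonneg (by positivity), div_le_one (by positivity)]
    have : (0 : ℝ) ≤ n := n.cast_nonneg
    linarith
  · intro n m hnm
    rw [Function.onFun, Set.disjoint_left]
    rintro y hn hm
    rw [Set.singleton_add] at hn hm
    obtain ⟨a, ha, han⟩ := hn
    obtain ⟨b, hb, hbm⟩ := hm
    -- translation along `e` changes the height only, so both points have the height of the graph
    have hpart : ∀ (t : ℝ) (p : Pt d), p ∈ Γ → φ (t • e + p - ⟪e, t • e + p⟫ • e) + t =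
        ⟪e, t • e + p⟫ := by
      intro t p hp
      have h1 : ⟪e, t • e + p⟫ = t + ⟪e, p⟫ := by
        rw [inner_add_right, real_inner_smul_right, hee, mul_one]
      have h2 : t • e + p - ⟪e, t • e + p⟫ • e = p - ⟪e, p⟫ • e := by rw [h1]; module
      have hp' : φ (p - ⟪e, p⟫ • e) = ⟪e, p⟫ := hp
      rw [h2, h1, hp']
      ring
    have h1 := hpart (1 / ((n : ℝ) + 1)) a ha
    have h2 := hpart (1 / ((m : ℝ) + 1)) b hb
    simp only [u] at han hbm
    rw [han] at h1
    rw [hbm] at h2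
    have h3 : (1 / ((n : ℝ) + 1)) = 1 / ((m : ℝ) + 1) := by linarith
    have h4 : (n : ℝ) + 1 = m + 1 := by
      simpa using h3
    exact hnm (by exact_mod_cast add_right_cancel h4)

lemma weakGrad_spec {v : Pt d → Pt d} (hv : MemH1 Ω v) :
    MemLp (fun x => flat (weakGrad Ω v x)) 2 (volume.restrict Ω) ∧
      IsWeakGradient Ω v (weakGrad Ω v) := by
  have h := hv.2
  rw [weakGrad, dif_pos h]
  exact h.choose_spec

/-- If a function with weak gradient agrees with an affine map on a simplex in `closure Ω`, its weak
gradient is constant there. -/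
lemma exists_weakGrad_ae_eq_const (hΩ : IsOpen Ω) (hfr : volume (frontier Ω) = 0)
    {T : TSimplex d} (hT : T.toSet ⊆ closure Ω) {v : Pt d → Pt d} (hv : MemH1 Ω v)
    {A : Pt d →ᵃ[ℝ] Pt d} (hA : v =ᵐ[volume.restrict T.toSet] A) :
    ∃ J : Mat d, weakGrad Ω v =ᵐ[volume.restrict T.toSet] fun _ => J := by
  obtain ⟨hLp, hweak⟩ := weakGrad_spec hv
  set G := weakGrad Ω v
  -- test functions supported in `U` are admissible for `v` and see only the affine values; what `U`
  -- misses of `T` lies in the two null sets `frontier T.toSet` and `frontier Ω`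
  let U : Set (Pt d) := interior T.toSet ∩ Ω
  have hU : IsOpen U := isOpen_interior.inter hΩ
  have hUΩ : U ⊆ Ω := Set.inter_subset_right
  have hUT : U ⊆ T.toSet := Set.inter_subset_left.trans interior_subset
  have hUfin : volume U < ⊤ := (measure_mono hUT).trans_lt T.volume_toSet_lt_top
  have : IsFiniteMeasure (volume.restrict U) := ⟨by simpa using hUfin⟩
  let J : Mat d := Matrix.of fun i j => A.linear (EuclideanSpace.single j 1) i
  refine ⟨J, ?_⟩
  have hij : ∀ i j, ∀ᵐ x ∂(volume : Measure (Pt d)), x ∈ U → G x i j - J i j = 0 := by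
    intro i j
    have hGint : IntegrableOn (fun x => G x i j) U := by
      have h1 : MemLp (fun x => flat (G x)) 2 (volume.restrict U) :=
        hLp.mono_measure (Measure.restrict_mono hUΩ le_rfl)
      have h2 := h1.integrable one_le_two
      exact (EuclideanSpace.proj (𝕜 := ℝ) ((i, j) : Fin d × Fin d)).integrable_comp h2
    refine hU.ae_eq_zero_of_integral_contDiff_smul_eq_zero
      (hGint.sub (integrableOn_const hUfin.ne)).locallyIntegrableOn ?_
    intro φ hφ hφc hφU
    have hφ0 : ∀ x, x ∉ U → φ x = 0 := fun x hx =>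
      image_eq_zero_of_notMem_tsupport fun h => hx (hφU h)
    have hdφ0 : ∀ x, x ∉ U → fderiv ℝ φ x = 0 := fun x hx =>
      image_eq_zero_of_notMem_tsupport fun h => hx (hφU (tsupport_fderiv_subset ℝ h))
    have hφcont : Continuous φ := hφ.continuous
    have hdφcont : Continuous fun x => fderiv ℝ φ x (EuclideanSpace.single j 1) :=
      (hφ.continuous_fderiv (by simp)).clm_apply continuous_const
    have hdφc : HasCompactSupport fun x => fderiv ℝ φ x (EuclideanSpace.single j 1) :=
      hφc.fderiv_apply ℝ _
    have hφint : Integrable φ := hφcont.integrable_of_hasCompactSupport hφc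
    have hA_cont : Continuous A := A.continuous_of_finiteDimensional
    let a : Pt d → ℝ := fun x => A x i
    have ha_cont : Continuous a := (EuclideanSpace.proj (𝕜 := ℝ) i).continuous.comp hA_cont
    have ha_deriv : ∀ x, HasFDerivAt a
        ((EuclideanSpace.proj (𝕜 := ℝ) i).comp A.linear.toContinuousLinearMap) x := by
      intro x
      have h1 : HasFDerivAt A A.linear.toContinuousLinearMap x := by
        have h2 : (A : Pt d → Pt d) = fun y => A.linear.toContinuousLinearMap y + A 0 := by
          ext1 y
          rw [A.decomp]
          simp
        rw [h2]
        exact (A.linear.toContinuousLinearMap.hasFDerivAt).add_const _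
      exact (EuclideanSpace.proj (𝕜 := ℝ) i).hasFDerivAt.comp x h1
    have ha_fderiv : ∀ x, fderiv ℝ a x (EuclideanSpace.single j 1) = J i j := by
      intro x
      rw [(ha_deriv x).fderiv]
      simp [J]
    have hparts : ∫ x, a x * fderiv ℝ φ x (EuclideanSpace.single j 1) =
        - ∫ x, fderiv ℝ a x (EuclideanSpace.single j 1) * φ x := by
      refine integral_mul_fderiv_eq_neg_fderiv_mul_of_integrable ?_ ?_ ?_
        (fun x _ => (ha_deriv x).differentiableAt)
        (fun x _ => (hφ.differentiable (by simp)).differentiableAt)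
      · simp only [ha_fderiv]
        exact hφint.const_mul _
      · exact (ha_cont.mul hdφcont).integrable_of_hasCompactSupport hdφc.mul_left
      · exact (ha_cont.mul hφcont).integrable_of_hasCompactSupport hφc.mul_left
    have hL : ∫ x in Ω, v x i * fderiv ℝ φ x (EuclideanSpace.single j 1) =
        ∫ x, a x * fderiv ℝ φ x (EuclideanSpace.single j 1) := by
      rw [setIntegral_eq_integral_of_forall_compl_eq_zero
          (fun x hx => by rw [hdφ0 x (fun h => hx (hUΩ h))]; simp),
        ← setIntegral_eq_integral_of_forall_compl_eq_zero (s := T.toSet)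
          (fun x hx => by rw [hdφ0 x (fun h => hx (hUT h))]; simp),
        ← setIntegral_eq_integral_of_forall_compl_eq_zero (s := T.toSet)
          (f := fun x => a x * _)
          (fun x hx => by rw [hdφ0 x (fun h => hx (hUT h))]; simp)]
      refine integral_congr_ae ?_
      filter_upwards [hA] with x hx
      rw [hx]
    have hR : ∫ x in Ω, G x i j * φ x = ∫ x in U, G x i j * φ x := by
      rw [setIntegral_eq_integral_of_forall_compl_eq_zero
          (fun x hx => by rw [hφ0 x (fun h => hx (hUΩ h)), mul_zero]),
        setIntegral_eq_integral_of_forall_compl_eq_zero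
          (fun x hx => by rw [hφ0 x hx, mul_zero])]
    have hmain := hweak φ hφ hφc (hφU.trans hUΩ) i j
    rw [hL, hparts, hR, neg_inj] at hmain
    simp only [ha_fderiv] at hmain
    rw [← setIntegral_eq_integral_of_forall_compl_eq_zero (s := U)
          (fun x hx => by rw [hφ0 x hx, mul_zero])] at hmain
    rw [← setIntegral_eq_integral_of_forall_compl_eq_zero (s := U)
          (fun x hx => by rw [hφ0 x hx, zero_smul])]
    obtain ⟨B, hB⟩ := hφcont.bounded_above_of_compact_support hφc
    have hGφ : Integrable (fun x => G x i j * φ x) (volume.restrict U) :=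
      hGint.mul_bdd hφcont.aestronglyMeasurable (Eventually.of_forall hB)
    have hJφ : Integrable (fun x => J i j * φ x) (volume.restrict U) :=
      hφint.restrict.const_mul _
    have : ∀ x, φ x • (G x i j - J i j) = G x i j * φ x - J i j * φ x := by
      intro x; rw [smul_eq_mul]; ring
    simp only [this]
    rw [integral_sub hGφ hJφ, hmain, sub_self]
  have hnull : ∀ᵐ x ∂(volume : Measure (Pt d)), x ∈ T.toSet → x ∈ U := by
    have h1 := T.volume_frontier_toSet
    rw [measure_eq_zero_iff_ae_notMem] at h1 hfr
    filter_upwards [h1, hfr] with x hx1 hx2 hxT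
    constructor
    · by_contra h
      exact hx1 ⟨subset_closure hxT, h⟩
    · by_contra h
      exact hx2 ⟨hT hxT, by rwa [hΩ.interior_eq]⟩
  rw [EventuallyEq, ae_restrict_iff' T.measurableSet_toSet]
  have hall := ae_all_iff.2 fun i => ae_all_iff.2 fun j => hij i j
  filter_upwards [hall, hnull] with x hx hxU hxT
  ext i j
  exact sub_eq_zero.1 (hx i j (hxU hxT))

variable {ΓD : Set (Pt d)} {𝒯 : Mesh d} {C : Mat d →ₗ[ℝ] Mat d} {z z' : State d} {T T' : TSimplex d}

/-- If the stress is constant on a simplex, `elementStress` recovers the constant. -/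
lemma elementStress_eq_of_ae_eq (hT : AffineIndependent ℝ T.vert) {s : Mat d}
    (h : stress Ω C z =ᵐ[volume.restrict T.toSet] fun _ => s) : elementStress Ω C z T = s := by
  ext i j
  have : ⨍ x in T.toSet, stress Ω C z x i j = ⨍ x in T.toSet, s i j := by
    refine average_congr ?_
    filter_upwards [h] with x hx
    rw [hx]
  rw [elementStress, Matrix.of_apply, this,
    setAverage_const (volume_toSet_pos hT).ne' T.volume_toSet_lt_top.ne]

lemma stress_ae_eq_elementStress (hΩ : IsReferenceDomain Ω ΓD)
    (hcover : closure Ω = ⋃ T ∈ 𝒯, T.toSet) (hz : z ∈ discreteSpace Ω ΓD 𝒯) (hT : T ∈ 𝒯)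
    (hnd : AffineIndependent ℝ T.vert) :
    stress Ω C z =ᵐ[volume.restrict T.toSet] fun _ => elementStress Ω C z T := by
  obtain ⟨⟨hv, hvV⟩, ⟨hq, -⟩, -⟩ := hz
  obtain ⟨A, hA⟩ := hv T hT
  obtain ⟨c, hc⟩ := hq T hT
  have hsub : T.toSet ⊆ closure Ω := by
    rw [hcover]; exact Set.subset_biUnion_of_mem (u := fun T : TSimplex d => T.toSet) hT
  obtain ⟨J, hJ⟩ := exists_weakGrad_ae_eq_const hΩ.isOpen hΩ.lipschitz.volume_frontier hsub
    hvV.1 hA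
  have h : stress Ω C z =ᵐ[volume.restrict T.toSet]
      fun _ => C ((1 / 2 : ℝ) • (J + J.transpose) - c) := by
    filter_upwards [hJ, hc] with x hx hx'
    rw [stress, strain, hx, hx']
  rw [elementStress_eq_of_ae_eq hnd h]
  exact h

/-- The element stress is inherited by the parts of an element. -/
lemma elementStress_eq_of_subset (hT' : AffineIndependent ℝ T'.vert) (hsub : T'.toSet ⊆ T.toSet)
    (h : stress Ω C z =ᵐ[volume.restrict T.toSet] fun _ => elementStress Ω C z T) :
    elementStress Ω C z T' = elementStress Ω C z T :=
  elementStress_eq_of_ae_eq hT' (ae_restrict_of_ae_restrict_of_subset hsub h)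

/-- The `L²(Ω)`-norm of a piecewise constant function. -/
lemma l2norm_sq_eq_sum {F : Type*} [NormedAddCommGroup F] (hfr : volume (frontier Ω) = 0)
    (hΩ : IsOpen Ω) (hcover : closure Ω = ⋃ T ∈ 𝒯, T.toSet)
    (hdisj : ∀ T ∈ 𝒯, ∀ T' ∈ 𝒯, T ≠ T' → volume (T.toSet ∩ T'.toSet) = 0) {w : Pt d → F}
    {c : TSimplex d → F} (hw : ∀ T ∈ 𝒯, w =ᵐ[volume.restrict T.toSet] fun _ => c T) :
    l2norm w (volume.restrict Ω) ^ 2 = ∑ T ∈ 𝒯, T.vol * ‖c T‖ ^ 2 := by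
  have hΩae : (Ω : Set (Pt d)) =ᵐ[volume] ⋃ T ∈ 𝒯, T.toSet := by
    rw [← hcover]
    refine (subset_closure.eventuallyLE).antisymm ?_
    rw [measure_eq_zero_iff_ae_notMem] at hfr
    filter_upwards [hfr] with x hx hxc
    by_contra h
    exact hx ⟨hxc, by rwa [hΩ.interior_eq]⟩
  have hlint : eLpNorm w 2 (volume.restrict Ω) ^ 2 =
      ENNReal.ofReal (∑ T ∈ 𝒯, T.vol * ‖c T‖ ^ 2) := by
    have h1 := eLpNorm_nnreal_pow_eq_lintegral (f := w) (μ := volume.restrict Ω) (p := 2)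
      two_ne_zero
    norm_num at h1
    rw [h1, Measure.restrict_congr_set hΩae, lintegral_biUnion_finset₀]
    · rw [ENNReal.ofReal_sum_of_nonneg
        (fun T _ => mul_nonneg T.vol_nonneg (sq_nonneg _))]
      refine Finset.sum_congr rfl fun T hT => ?_
      have h2 : ∫⁻ x in T.toSet, ‖w x‖ₑ ^ 2 = ∫⁻ x in T.toSet, ‖c T‖ₑ ^ 2 := by
        refine lintegral_congr_ae ?_
        filter_upwards [hw T hT] with x hx
        rw [hx]
      rw [h2, setLIntegral_const, ENNReal.ofReal_mul T.vol_nonneg, T.ofReal_vol,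
        ENNReal.ofReal_pow (norm_nonneg _), ofReal_norm, mul_comm]
    · intro T hT T' hT' hne
      exact hdisj T hT T' hT' hne
    · exact fun T _ => T.measurableSet_toSet.nullMeasurableSet
  rw [l2norm, ← ENNReal.toReal_pow, hlint, ENNReal.toReal_ofReal]
  exact Finset.sum_nonneg fun T _ => mul_nonneg T.vol_nonneg (sq_nonneg _)

end Analysis

/-! ### Neighbours in a refinement -/

section Neighbours

variable {d : ℕ} {𝒯 𝒯' : Mesh d} {T T₁ T₁' : TSimplex d} {i : Fin (d + 1)}

lemma SharesFace.faceCenter_mem (hd : d ≠ 0) (h : SharesFace T i T₁) :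
    T.faceCenter i ∈ T₁.toSet := by
  obtain ⟨-, j, hj⟩ := h
  have := faceCenter_mem_face hd T i
  rw [face, ← hj] at this
  exact T₁.face_subset_toSet j this

/-- The neighbour of a non-refined element in the refined mesh is a part of its neighbour in the
original mesh. -/
lemma Refines.exists_neighbour (hd : d ≠ 0) (hr : Refines 𝒯 𝒯') (hc : IsConforming 𝒯)
    (hc' : IsConforming 𝒯') (hnd : ∀ T ∈ 𝒯, AffineIndependent ℝ T.vert)
    (hnd' : ∀ T ∈ 𝒯', AffineIndependent ℝ T.vert) (hT : T ∈ 𝒯) (hT' : T ∈ 𝒯') (hT₁' : T₁' ∈ 𝒯')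
    (hs : SharesFace T i T₁') : ∃ T₁ ∈ 𝒯, SharesFace T i T₁ ∧ T₁'.toSet ⊆ T₁.toSet := by
  obtain ⟨P, hP, hsub⟩ := hr.exists_parent T₁' hT₁'
  refine ⟨P, hP, ?_, hsub⟩
  refine hc.sharesFace_of_faceCenter_mem hd hnd hT hP ?_ (hsub (hs.faceCenter_mem hd))
  rintro rfl
  have h0 := hc'.volume_inter_eq_zero hnd' hT₁' hT' hs.1
  rw [Set.inter_eq_left.2 hsub] at h0
  exact (volume_toSet_pos (hnd' _ hT₁')).ne' h0

lemma Refines.isInteriorFace_iff (hd : d ≠ 0) (hr : Refines 𝒯 𝒯') (hc : IsConforming 𝒯)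
    (hc' : IsConforming 𝒯') (hnd : ∀ T ∈ 𝒯, AffineIndependent ℝ T.vert)
    (hnd' : ∀ T ∈ 𝒯', AffineIndependent ℝ T.vert) (hT : T ∈ 𝒯) (hT' : T ∈ 𝒯') :
    IsInteriorFace 𝒯' T i ↔ IsInteriorFace 𝒯 T i := by
  constructor
  · rintro ⟨T₁', hT₁', hs⟩
    obtain ⟨T₁, hT₁, hs', -⟩ := hr.exists_neighbour hd hc hc' hnd hnd' hT hT' hT₁' hs
    exact ⟨T₁, hT₁, hs'⟩
  · rintro ⟨T₁, hT₁, hs⟩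
    obtain ⟨P, hP, hx, hsub⟩ := hr.exists_part T₁ hT₁ _ (hs.faceCenter_mem hd)
    refine ⟨P, hP, hc'.sharesFace_of_faceCenter_mem hd hnd' hT' hP ?_ hx⟩
    rintro rfl
    have h0 := hc.volume_inter_eq_zero hnd hT hT₁ hs.1.symm
    rw [Set.inter_eq_left.2 hsub] at h0
    exact (volume_toSet_pos (hnd _ hT)).ne' h0

open scoped Classical in
lemma IsConforming.filter_sharesFace_eq_singleton (hd : d ≠ 0) (hc : IsConforming 𝒯)
    (hnd : ∀ T ∈ 𝒯, AffineIndependent ℝ T.vert) (hT : T ∈ 𝒯) (hT₁ : T₁ ∈ 𝒯)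
    (hs : SharesFace T i T₁) : 𝒯.filter (SharesFace T i) = {T₁} := by
  ext P
  simp only [Finset.mem_filter, Finset.mem_singleton]
  constructor
  · rintro ⟨hP, hPs⟩
    exact hc.sharesFace_unique hd hnd hT hP hT₁ hPs hs
  · rintro rfl
    exact ⟨hT₁, hs⟩

open scoped Classical in
/-- Each element occurs at most `d + 1` times as a neighbour, once for each of its faces. -/
lemma IsConforming.sum_neighbours_le (hd : d ≠ 0) (hc : IsConforming 𝒯)
    (hnd : ∀ T ∈ 𝒯, AffineIndependent ℝ T.vert) {a : TSimplex d → ℝ} (ha : ∀ T, 0 ≤ a T) :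
    ∑ T ∈ 𝒯, ∑ i, ∑ P ∈ 𝒯.filter (SharesFace T i), a P ≤ (d + 1) * ∑ P ∈ 𝒯, a P := by
  have hcard : ∀ P ∈ 𝒯, ((𝒯 ×ˢ (Finset.univ : Finset (Fin (d + 1)))).filter
      fun p => SharesFace p.1 p.2 P).card ≤ d + 1 := by
    intro P hP
    choose! f hf using fun p : TSimplex d × Fin (d + 1) =>
      fun h : SharesFace p.1 p.2 P => h.2
    refine (Finset.card_le_card_of_injOn f (fun p _ => Finset.mem_univ _) ?_).trans (by simp)
    rintro ⟨T, i⟩ hp ⟨S, k⟩ hq hfpq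
    simp only [Finset.coe_filter, Finset.mem_product, Finset.mem_univ, and_true,
      Set.mem_ofPred_eq] at hp hq
    have h1 := hf (T, i) hp.2
    have h2 := hf (S, k) hq.2
    have hTS : T = S := hc.sharesFace_unique hd hnd hP hp.1 hq.1 (i := f (T, i))
      ⟨hp.2.1.symm, i, h1.symm⟩ ⟨hq.2.1.symm, k, by rw [hfpq]; exact h2.symm⟩
    subst hTS
    have hik : i = k := by
      apply faceVert_injective (hnd T hp.1)
      rw [← h1, hfpq, h2]
    rw [hik]
  calc ∑ T ∈ 𝒯, ∑ i, ∑ P ∈ 𝒯.filter (SharesFace T i), a P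
      = ∑ p ∈ 𝒯 ×ˢ (Finset.univ : Finset (Fin (d + 1))), ∑ P ∈ 𝒯,
          if SharesFace p.1 p.2 P then a P else 0 := by
        rw [Finset.sum_product]
        simp only [Finset.sum_filter]
    _ = ∑ P ∈ 𝒯, ((𝒯 ×ˢ (Finset.univ : Finset (Fin (d + 1)))).filter
          fun p => SharesFace p.1 p.2 P).card * a P := by
        rw [Finset.sum_comm]
        refine Finset.sum_congr rfl fun P _ => ?_
        rw [← Finset.sum_filter, Finset.sum_const, nsmul_eq_mul]
    _ ≤ ∑ P ∈ 𝒯, (d + 1) * a P := by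
        refine Finset.sum_le_sum fun P hP => mul_le_mul_of_nonneg_right ?_ (ha P)
        exact_mod_cast hcard P hP
    _ = (d + 1) * ∑ P ∈ 𝒯, a P := by rw [Finset.mul_sum]

end Neighbours

/-! ### Perturbation of the face residuals -/

section Residuals

variable {d : ℕ}

lemma matVec_sub (σ τ : Mat d) (ν : Pt d) : matVec (σ - τ) ν = matVec σ ν - matVec τ ν := by
  ext i
  simp [matVec, Matrix.sub_mulVec]

lemma flat_sub (σ τ : Mat d) : flat (σ - τ) = flat σ - flat τ := by
  ext p
  simp [flat]

lemma norm_matVec_le (σ : Mat d) (ν : Pt d) : ‖matVec σ ν‖ ≤ ‖flat σ‖ * ‖ν‖ := by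
  refine le_of_sq_le_sq ?_ (by positivity)
  rw [mul_pow, EuclideanSpace.real_norm_sq_eq, EuclideanSpace.real_norm_sq_eq,
    EuclideanSpace.real_norm_sq_eq, Fintype.sum_prod_type, Finset.sum_mul]
  refine Finset.sum_le_sum fun i _ => ?_
  simpa [matVec, flat, Matrix.mulVec, dotProduct] using
    Finset.sum_mul_sq_le_sq_mul_sq Finset.univ (fun j => σ i j) (fun j => ν j)

lemma norm_normal_le (T : TSimplex d) (i : Fin (d + 1)) : ‖T.normal i‖ ≤ 1 := by
  rw [normal]
  simp only [norm_neg, norm_smul, norm_inv, norm_norm]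
  exact inv_mul_le_one

lemma norm_matVec_normal_le (σ : Mat d) (T : TSimplex d) (i : Fin (d + 1)) :
    ‖matVec σ (T.normal i)‖ ≤ ‖flat σ‖ :=
  (norm_matVec_le _ _).trans (mul_le_of_le_one_right (norm_nonneg _) (norm_normal_le T i))

/-- For infinite `μ` both sides vanish, through `ENNReal.toReal`. -/
lemma l2norm_const {F : Type*} [NormedAddCommGroup F] (c : F) (μ : Measure (Pt d)) :
    l2norm (fun _ => c) μ = ‖c‖ * Real.sqrt (μ Set.univ).toReal := by
  rw [l2norm, eLpNorm_const' _ (by norm_num) (by norm_num), ENNReal.toReal_mul, toReal_enorm,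
    ← ENNReal.toReal_rpow, Real.sqrt_eq_rpow]
  norm_num

lemma abs_l2norm_sub_l2norm_le {F : Type*} [NormedAddCommGroup F] {u w : Pt d → F}
    {μ : Measure (Pt d)} (hu : MemLp u 2 μ) (hw : MemLp w 2 μ) :
    |l2norm u μ - l2norm w μ| ≤ l2norm (fun x => u x - w x) μ := by
  have := abs_norm_sub_norm_le (hu.toLp u) (hw.toLp w)
  rw [← MemLp.toLp_sub] at this
  simp only [Lp.norm_toLp] at this
  exact this

variable {Ω ΓD : Set (Pt d)} {𝒯 𝒯' : Mesh d} {C : Mat d →ₗ[ℝ] Mat d} {g : Pt d → Pt d}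
  {z z' : State d} {T : TSimplex d}

/-- The difference of the two discrete stresses on an element of the refined mesh. -/
def stressDiff (Ω : Set (Pt d)) (C : Mat d →ₗ[ℝ] Mat d) (z' z : State d) (T : TSimplex d) :
    EuclideanSpace ℝ (Fin d × Fin d) :=
  flat (elementStress Ω C z' T - elementStress Ω C z T)

open scoped Classical in
/-- The face residual of a non-refined element changes by the change of the stress on the element
and on its neighbour in the refined mesh. -/
lemma abs_faceResidual_sub_le (hd : d ≠ 0) (hr : Refines 𝒯 𝒯') (hc : IsConforming 𝒯)
    (hc' : IsConforming 𝒯') (hnd : ∀ T ∈ 𝒯, AffineIndependent ℝ T.vert)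
    (hnd' : ∀ T ∈ 𝒯', AffineIndependent ℝ T.vert) (hT : T ∈ 𝒯) (hT' : T ∈ 𝒯')
    (hconst : ∀ T ∈ 𝒯, stress Ω C z =ᵐ[volume.restrict T.toSet] fun _ => elementStress Ω C z T)
    (hg : MemLp g 2 ((surf d).restrict (neumann Ω ΓD))) (i : Fin (d + 1)) :
    |faceResidual Ω ΓD C g 𝒯' z' T i - faceResidual Ω ΓD C g 𝒯 z T i| ≤
      (‖stressDiff Ω C z' z T‖ +
        ∑ P ∈ 𝒯'.filter (SharesFace T i), ‖stressDiff Ω C z' z P‖) *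
          Real.sqrt (surf d (T.face i)).toReal := by
  have hnonneg : 0 ≤ ∑ P ∈ 𝒯'.filter (SharesFace T i), ‖stressDiff Ω C z' z P‖ :=
    Finset.sum_nonneg fun _ _ => norm_nonneg _
  have hiff := hr.isInteriorFace_iff hd hc hc' hnd hnd' hT hT' (i := i)
  by_cases hint : IsInteriorFace 𝒯' T i
  · obtain ⟨T₁', hT₁', hs'⟩ := hint
    obtain ⟨T₁, hT₁, hs, hsub⟩ := hr.exists_neighbour hd hc hc' hnd hnd' hT hT' hT₁' hs'
    rw [faceResidual, if_pos ⟨T₁', hT₁', hs'⟩, faceResidual, if_pos ⟨T₁, hT₁, hs⟩, stressJump,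
      stressJump, hc'.filter_sharesFace_eq_singleton hd hnd' hT' hT₁' hs',
      hc.filter_sharesFace_eq_singleton hd hnd hT hT₁ hs, Finset.sum_singleton,
      Finset.sum_singleton, Finset.sum_singleton, l2norm_const, l2norm_const,
      Measure.restrict_apply_univ, ← sub_mul, abs_mul, abs_of_nonneg (Real.sqrt_nonneg _),
      ← elementStress_eq_of_subset (hnd' _ hT₁') hsub (hconst _ hT₁)]
    refine mul_le_mul_of_nonneg_right ?_ (Real.sqrt_nonneg _)
    refine (abs_norm_sub_norm_le _ _).trans ?_
    rw [← matVec_sub]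
    refine (norm_matVec_normal_le _ _ _).trans ?_
    refine le_trans (le_of_eq ?_) (norm_sub_le _ _)
    rw [stressDiff, stressDiff, ← flat_sub]
    congr 2
    abel
  · have hint' : ¬ IsInteriorFace 𝒯 T i := fun h => hint (hiff.2 h)
    by_cases hN : IsNeumannFace Ω ΓD T i
    · rw [faceResidual, if_neg hint, if_pos hN, faceResidual, if_neg hint', if_pos hN]
      have hle : (surf d).restrict (T.face i) ≤ (surf d).restrict (neumann Ω ΓD) := by
        refine Measure.restrict_mono' ?_ le_rfl
        exact ae_le_set.2 hN
      have hg' : MemLp g 2 ((surf d).restrict (T.face i)) := hg.mono_measure hle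
      have : IsFiniteMeasure ((surf d).restrict (T.face i)) :=
        ⟨by simpa using surf_face_lt_top hd T i⟩
      refine (abs_l2norm_sub_l2norm_le (hg'.sub (memLp_const _)) (hg'.sub (memLp_const _))).trans ?_
      simp only [Pi.sub_apply, sub_sub_sub_cancel_left]
      rw [l2norm_const, Measure.restrict_apply_univ, ← matVec_sub]
      refine mul_le_mul_of_nonneg_right ?_ (Real.sqrt_nonneg _)
      refine (norm_matVec_normal_le _ _ _).trans ?_
      rw [flat_sub, norm_sub_rev, ← flat_sub]
      exact le_add_of_nonneg_right hnonneg
    · rw [faceResidual, if_neg hint, if_neg hN, faceResidual, if_neg hint', if_neg hN, sub_zero,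
        abs_zero]
      positivity

/-- The reverse triangle inequality for the Euclidean norm. -/
lemma abs_sqrt_sum_sq_sub_le {ι : Type*} (s : Finset ι) (a b : ι → ℝ) :
    |Real.sqrt (∑ k ∈ s, a k ^ 2) - Real.sqrt (∑ k ∈ s, b k ^ 2)| ≤
      Real.sqrt (∑ k ∈ s, (a k - b k) ^ 2) := by
  have := abs_norm_sub_norm_le (WithLp.toLp 2 fun k : s => a k) (WithLp.toLp 2 fun k : s => b k)
  rw [← WithLp.toLp_sub] at this
  simp only [EuclideanSpace.norm_eq, Real.norm_eq_abs, sq_abs, Pi.sub_apply] at this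
  rw [← Finset.sum_coe_sort s, ← Finset.sum_coe_sort s, ← Finset.sum_coe_sort s]
  exact this

lemma sq_refinementIndicator_sub_le (f : Pt d → Pt d) :
    (refinementIndicator Ω ΓD C f g 𝒯' z' T - refinementIndicator Ω ΓD C f g 𝒯 z T) ^ 2 ≤
      Real.sqrt T.vol *
        ∑ i, (faceResidual Ω ΓD C g 𝒯' z' T i - faceResidual Ω ΓD C g 𝒯 z T i) ^ 2 := by
  -- the volume term, which does not change, and the weighted face residuals form a vector
  let vec : (Fin (d + 1) → ℝ) → Option (Fin (d + 1)) → ℝ := fun R k =>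
    k.elim (Real.sqrt (T.vol * l2norm f (volume.restrict T.toSet) ^ 2))
      fun i => Real.sqrt (Real.sqrt T.vol) * R i
  have hsum : ∀ R : Fin (d + 1) → ℝ, T.vol * l2norm f (volume.restrict T.toSet) ^ 2 +
      Real.sqrt T.vol * ∑ i, R i ^ 2 = ∑ k, vec R k ^ 2 := by
    intro R
    rw [Fintype.sum_option]
    simp only [vec, Option.elim, mul_pow]
    rw [Real.sq_sqrt (mul_nonneg T.vol_nonneg (sq_nonneg _)), Real.sq_sqrt (Real.sqrt_nonneg _),
      Finset.mul_sum]
  rw [refinementIndicator, refinementIndicator, hsum, hsum, ← sq_abs]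
  refine (pow_le_pow_left₀ (abs_nonneg _) (abs_sqrt_sum_sq_sub_le _ _ _) 2).trans ?_
  rw [Real.sq_sqrt (Finset.sum_nonneg fun _ _ => sq_nonneg _), Fintype.sum_option]
  simp only [vec, Option.elim, ← mul_sub, mul_pow, sub_self]
  rw [Real.sq_sqrt (Real.sqrt_nonneg _), Finset.mul_sum]
  simp

end Residuals

/-! ### Stability on non-refined elements -/

section Stability

variable {d : ℕ}

open scoped Classical in
/-- The stability estimate for two meshes of which the second refines the first, with a constant
that depends on the bound `K` for the weights of the face residuals. -/
lemma abs_sqrt_sum_sub_le {K : ℝ} (hK : 0 ≤ K) (hd : d ≠ 0) {Ω ΓD : Set (Pt d)}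
    (hΩ : IsReferenceDomain Ω ΓD) {𝒯 𝒯' : Mesh d} (hr : Refines 𝒯 𝒯') (hc : IsConforming 𝒯)
    (hc' : IsConforming 𝒯') (hnd : ∀ T ∈ 𝒯, AffineIndependent ℝ T.vert)
    (hnd' : ∀ T ∈ 𝒯', AffineIndependent ℝ T.vert) (hcover : closure Ω = ⋃ T ∈ 𝒯, T.toSet)
    (hweight : ∀ T ∈ 𝒯', ∀ P ∈ 𝒯', ∀ i j, P.faceVert j = T.faceVert i →
      Real.sqrt T.vol * (surf d (T.face i)).toReal ≤ K * P.vol)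
    {C : Mat d →ₗ[ℝ] Mat d} {f g : Pt d → Pt d}
    (hg : MemLp g 2 ((surf d).restrict (neumann Ω ΓD))) {S : Finset (TSimplex d)}
    (hS : ∀ T ∈ S, T ∈ 𝒯 ∧ T ∈ 𝒯') {z z' : State d} (hz : z ∈ discreteSpace Ω ΓD 𝒯)
    (hz' : z' ∈ discreteSpace Ω ΓD 𝒯') :
    |Real.sqrt (∑ T ∈ S, refinementIndicator Ω ΓD C f g 𝒯' z' T ^ 2) -
      Real.sqrt (∑ T ∈ S, refinementIndicator Ω ΓD C f g 𝒯 z T ^ 2)| ≤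
      Real.sqrt (4 * K * (d + 1)) * errorMeasure Ω C z' z := by
  have hcover' : closure Ω = ⋃ T ∈ 𝒯', T.toSet := by rw [hcover, hr.iUnion_eq]
  have hconst : ∀ T ∈ 𝒯, stress Ω C z =ᵐ[volume.restrict T.toSet] fun _ => elementStress Ω C z T :=
    fun T hT => stress_ae_eq_elementStress hΩ hcover hz hT (hnd T hT)
  have hconst' : ∀ T ∈ 𝒯', (fun x => flat (stress Ω C z' x - stress Ω C z x))
      =ᵐ[volume.restrict T.toSet] fun _ => stressDiff Ω C z' z T := by
    intro T hT
    obtain ⟨P, hP, hsub⟩ := hr.exists_parent T hT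
    filter_upwards [stress_ae_eq_elementStress (C := C) hΩ hcover' hz' hT (hnd' T hT),
      ae_restrict_of_ae_restrict_of_subset hsub (hconst P hP)] with x h1 h2
    rw [h1, h2, stressDiff, elementStress_eq_of_subset (hnd' T hT) hsub (hconst P hP)]
  let a : TSimplex d → ℝ := fun T => T.vol * ‖stressDiff Ω C z' z T‖ ^ 2
  have ha : ∀ T, 0 ≤ a T := fun T => mul_nonneg T.vol_nonneg (sq_nonneg _)
  have herr : errorMeasure Ω C z' z ^ 2 = ∑ T ∈ 𝒯', a T :=
    l2norm_sq_eq_sum hΩ.lipschitz.volume_frontier hΩ.isOpen hcover'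
      (fun T hT P hP hne => hc'.volume_inter_eq_zero hnd' hT hP hne) hconst'
  have herr0 : 0 ≤ errorMeasure Ω C z' z := ENNReal.toReal_nonneg
  have hface : ∀ T ∈ S, ∀ i, Real.sqrt T.vol *
      (faceResidual Ω ΓD C g 𝒯' z' T i - faceResidual Ω ΓD C g 𝒯 z T i) ^ 2 ≤
      2 * K * (a T + ∑ P ∈ 𝒯'.filter (SharesFace T i), a P) := by
    intro T hTS i
    obtain ⟨hT, hT'⟩ := hS T hTS
    have h1 := abs_faceResidual_sub_le hd hr hc hc' hnd hnd' hT hT' hconst hg i (z' := z')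
    set σ := ∑ P ∈ 𝒯'.filter (SharesFace T i), ‖stressDiff Ω C z' z P‖
    set w := Real.sqrt T.vol * (surf d (T.face i)).toReal
    have hw0 : 0 ≤ w := mul_nonneg (Real.sqrt_nonneg _) ENNReal.toReal_nonneg
    -- there is at most one neighbour, so the square of the sum is the sum of the squares
    have hσ : w * σ ^ 2 ≤ K * ∑ P ∈ 𝒯'.filter (SharesFace T i), a P := by
      by_cases hint : IsInteriorFace 𝒯' T i
      · obtain ⟨P, hP, hs⟩ := hint
        obtain ⟨j, hj⟩ := hs.2
        simp only [σ, hc'.filter_sharesFace_eq_singleton hd hnd' hT' hP hs, Finset.sum_singleton, a]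
        rw [← mul_assoc]
        exact mul_le_mul_of_nonneg_right (hweight T hT' P hP i j hj) (sq_nonneg _)
      · have hempty : 𝒯'.filter (SharesFace T i) = ∅ :=
          Finset.filter_eq_empty_iff.2 fun P hP hs => hint ⟨P, hP, hs⟩
        simp [σ, hempty]
    have hδ : w * ‖stressDiff Ω C z' z T‖ ^ 2 ≤ K * a T := by
      simp only [a]
      rw [← mul_assoc]
      exact mul_le_mul_of_nonneg_right (hweight T hT' T hT' i i rfl) (sq_nonneg _)
    have hsq : (faceResidual Ω ΓD C g 𝒯' z' T i - faceResidual Ω ΓD C g 𝒯 z T i) ^ 2 ≤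
        (‖stressDiff Ω C z' z T‖ + σ) ^ 2 * (surf d (T.face i)).toReal := by
      rw [← sq_abs]
      refine (pow_le_pow_left₀ (abs_nonneg _) h1 2).trans ?_
      rw [mul_pow, Real.sq_sqrt ENNReal.toReal_nonneg]
    calc _ ≤ Real.sqrt T.vol *
          ((‖stressDiff Ω C z' z T‖ + σ) ^ 2 * (surf d (T.face i)).toReal) :=
          mul_le_mul_of_nonneg_left hsq (Real.sqrt_nonneg _)
      _ = w * (‖stressDiff Ω C z' z T‖ + σ) ^ 2 := by simp only [w]; ring
      _ ≤ w * (2 * (‖stressDiff Ω C z' z T‖ ^ 2 + σ ^ 2)) :=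
          mul_le_mul_of_nonneg_left (add_sq_le) hw0
      _ = 2 * (w * ‖stressDiff Ω C z' z T‖ ^ 2 + w * σ ^ 2) := by ring
      _ ≤ 2 * (K * a T + K * ∑ P ∈ 𝒯'.filter (SharesFace T i), a P) := by gcongr
      _ = _ := by ring
  have hS' : S ⊆ 𝒯' := fun T hT => (hS T hT).2
  have hsum : ∑ T ∈ S, (refinementIndicator Ω ΓD C f g 𝒯' z' T -
      refinementIndicator Ω ΓD C f g 𝒯 z T) ^ 2 ≤
      4 * K * (d + 1) * errorMeasure Ω C z' z ^ 2 := by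
    calc _ ≤ ∑ T ∈ S, ∑ i, 2 * K * (a T + ∑ P ∈ 𝒯'.filter (SharesFace T i), a P) := by
          refine Finset.sum_le_sum fun T hT => (sq_refinementIndicator_sub_le f).trans ?_
          rw [Finset.mul_sum]
          exact Finset.sum_le_sum fun i _ => hface T hT i
      _ ≤ ∑ T ∈ 𝒯', ∑ i, 2 * K * (a T + ∑ P ∈ 𝒯'.filter (SharesFace T i), a P) := by
          refine Finset.sum_le_sum_of_subset_of_nonneg hS' fun T _ _ => ?_
          refine Finset.sum_nonneg fun i _ => mul_nonneg (by positivity) ?_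
          exact add_nonneg (ha T) (Finset.sum_nonneg fun P _ => ha P)
      _ = 2 * K * ((d + 1) * ∑ T ∈ 𝒯', a T +
            ∑ T ∈ 𝒯', ∑ i, ∑ P ∈ 𝒯'.filter (SharesFace T i), a P) := by
          simp only [← Finset.mul_sum, Finset.sum_add_distrib, Finset.sum_const, Finset.card_univ,
            Fintype.card_fin, nsmul_eq_mul]
          push_cast
          ring
      _ ≤ 2 * K * ((d + 1) * ∑ T ∈ 𝒯', a T + (d + 1) * ∑ T ∈ 𝒯', a T) := by
          gcongr
          exact hc'.sum_neighbours_le hd hnd' ha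
      _ = _ := by rw [herr]; ring
  refine (abs_sqrt_sum_sq_sub_le _ _ _).trans ?_
  refine (Real.sqrt_le_sqrt hsum).trans (le_of_eq ?_)
  rw [Real.sqrt_mul (by positivity), Real.sqrt_sq herr0]

end Stability

end Elastoplasticity

end

open Elastoplasticity
theorem lemma4p1 (d : ℕ) (hd : d = 2 ∨ d = 3) (Ω ΓD : Set (Pt d))
    (hΩ : IsReferenceDomain Ω ΓD) (𝒯₀ : Mesh d) (h𝒯₀ : IsMesh Ω ΓD 𝒯₀) :
    ∃ C₁ : ℝ, 0 < C₁ ∧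
      ∀ C : Mat d →ₗ[ℝ] Mat d, IsElasticityTensor C →
      ∀ f : Pt d → Pt d, MemLp f 2 (volume.restrict Ω) →
      ∀ g : Pt d → Pt d, MemLp g 2 ((surf d).restrict (neumann Ω ΓD)) →
      ∀ 𝒯 ∈ refinements 𝒯₀, ∀ 𝒯' ∈ refinements 𝒯,
      ∀ S : Finset (TSimplex d), (∀ T ∈ S, T ∈ 𝒯 ∧ T ∈ 𝒯') →
      ∀ z ∈ discreteSpace Ω ΓD 𝒯, ∀ z' ∈ discreteSpace Ω ΓD 𝒯',
        |Real.sqrt (∑ T ∈ S, refinementIndicator Ω ΓD C f g 𝒯' z' T ^ 2) -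
          Real.sqrt (∑ T ∈ S, refinementIndicator Ω ΓD C f g 𝒯 z T ^ 2)| ≤
          C₁ * errorMeasure Ω C z' z := by
  have hd0 : d ≠ 0 := by omega
  obtain ⟨𝓔, hfin, hneg, h𝓔⟩ := exists_finite_frames hd h𝒯₀.nondegenerate h𝒯₀.typ_lt
  obtain ⟨K, hK, hreg⟩ := exists_isShapeRegular hfin
  have hK0 : 0 < K := one_pos.trans_le hK
  have hher := hereditary_hasFrameIn hd hneg
  refine ⟨Real.sqrt (4 * K ^ (2 * d + 3) * (d + 1)), Real.sqrt_pos.2 (by positivity), ?_⟩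
  intro C _ f _ g hg 𝒯 h𝒯 𝒯' h𝒯' S hS z hz z' hz'
  obtain ⟨hP, hc, hr⟩ :=
    refinements_induction hd hher (fun T hT => hT.typ_lt) h𝓔 h𝒯₀.conforming h𝒯
  obtain ⟨hP', hc', hr'⟩ := refinements_induction hd hher (fun T hT => hT.typ_lt) hP hc h𝒯'
  refine abs_sqrt_sum_sub_le (by positivity) hd0 hΩ hr' hc hc' (fun T hT => (hP T hT).nondegenerate)
    (fun T hT => (hP' T hT).nondegenerate) ?_ ?_ hg hS hz hz'
  · rw [h𝒯₀.cover, hr.iUnion_eq]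
  · intro T hT P hPP i j hface
    obtain ⟨h, hh, hh1, hTreg⟩ := hreg T (hP' T hT)
    obtain ⟨h', -, -, hPreg⟩ := hreg P (hP' P hPP)
    exact hTreg.sqrt_vol_mul_surf_le (by omega) hK hh hh1 hPreg hface
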